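/- Let $M\subset\mathbb{R}^3$ be a complete convex surface of class $C^2$ (the whole boundary of a closed convex set with non-empty interior) whose Gaussian curvature satisfies $K\ge K_1$ for some constant $K_1>0$. Let $r_i$ be the injectivity radius of $M$ and $d$ its intrinsic distance. Let $A^\circ B^\circ C^\circ D^\circ$ be a convex geodesic quadrilateral on $M$: a compact region that contains, with any two of its points, a shortest arc of $M$ joining them, and whose boundary in $M$ is a simple closed curve formed by shortest arcs $A^\circ B^\circ$, $B^\circ C^\circ$, $C^\circ D^\circ$, $D^\circ A^\circ$. Suppose that it lies in the open geodesic disc of centre $A^\circ$ and radius $r_i$ and that its perimeter is less than $2r_i$. Let $w_A,w_B,w_C,w_D>0$ be weights, and let $P_F$ be a corresponding weighted Fermat–Torricelli point, i.e. a point of $M$ at which $$f(X)=w_A\,d(X,A^\circ)+w_B\,d(X,B^\circ)+w_C\,d(X,C^\circ)+w_D\,d(X,D^\circ)$$ attains its minimum over $M$. Suppose that $P_F$ is an interior point of the quadrilateral. For $R\in\{A,B,C,D\}$ let $\gamma_R$ be the unit speed geodesic with $\gamma_R(0)=P_F$ that contains the shortest arc from $P_F$ to $R^\circ$, let $R=\gamma_R(w_R)$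 be the point at arc length $w_R$ from $P_F$ on it, and let $R'=\exp_{P_F}^{-1}(R)\in T_{P_F}M$. Here $\exp_{P_F}^{-1}$ is taken along $\gamma_R$: $R'$ is the vector with $\exp_{P_F}(sR')=\gamma_R(s\,w_R)$ for $0\le s\le1$. It satisfies $|R'|=w_R$, and if $w_R$ is less than the injectivity radius at $P_F$, then $R'$ is the only vector of $T_{P_F}M$ shorter than that radius with $\exp_{P_F}(R')=R$. Let $A'^\star=-A'$ and $C'^\star=-C'$ be the reflections of $A'$ and $C'$ through $P_F$ (the origin of $T_{P_F}M$). Then $A'^\star B'C'^\star D'$ is a non-degenerate parallelogram in $T_{P_F}M$. -/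

import Mathlib

open Set Filter Topology
open scoped ENNReal NNReal

noncomputable section

namespace ConvexSurface

/-- Euclidean three-space. -/
abbrev E3 : Type := EuclideanSpace ℝ (Fin 3)

/-- The parameter plane. -/
abbrev E2 : Type := EuclideanSpace ℝ (Fin 2)

/-! ### Surfaces of class `C²` and their Gaussian curvature -/

/-- `X : U → M` is a regular `C²` parametrization of an open piece of `M`: a `C²` immersion that
is a homeomorphism of the open set `U` onto a (relatively) open subset of `M`. -/
structure IsChart (M : Set E3) (X : E2 → E3) (U : Set E2) : Prop where
  isOpen : IsOpen U
  contDiffOn : ContDiffOn ℝ 2 X U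
  immersion : ∀ u ∈ U, Function.Injective (fderiv ℝ X u)
  injOn : InjOn X U
  isOpenMap : ∀ W ⊆ U, IsOpen W → ∃ O : Set E3, IsOpen O ∧ X '' W = O ∩ M

/-- First partial derivatives of a parametrization. -/
def partial1 (X : E2 → E3) (u : E2) (i : Fin 2) : E3 :=
  fderiv ℝ X u (EuclideanSpace.single i 1)

/-- Second partial derivatives of a parametrization. -/
def partial2 (X : E2 → E3) (u : E2) (i j : Fin 2) : E3 :=
  fderiv ℝ (fderiv ℝ X) u (EuclideanSpace.single i 1) (EuclideanSpace.single j 1)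

/-- The normal vector `X₀ × X₁`. -/
def normalVec (X : E2 → E3) (u : E2) : E3 :=
  WithLp.toLp 2 (crossProduct (WithLp.ofLp (partial1 X u 0)) (WithLp.ofLp (partial1 X u 1)))

/-- The unit normal `X₀ × X₁ / ‖X₀ × X₁‖`. -/
def unitNormal (X : E2 → E3) (u : E2) : E3 :=
  ‖normalVec X u‖⁻¹ • normalVec X u

/-- Matrix of the first fundamental form. -/
def firstForm (X : E2 → E3) (u : E2) : Matrix (Fin 2) (Fin 2) ℝ :=
  Matrix.of fun i j => inner ℝ (partial1 X u i) (partial1 X u j)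

/-- Matrix of the second fundamental form. -/
def secondForm (X : E2 → E3) (u : E2) : Matrix (Fin 2) (Fin 2) ℝ :=
  Matrix.of fun i j => inner ℝ (partial2 X u i j) (unitNormal X u)

/-- Gaussian curvature at the point `X u`. -/
def gaussCurvature (X : E2 → E3) (u : E2) : ℝ :=
  (secondForm X u).det / (firstForm X u).det

/-- `M` is a complete convex surface of class `C²`: the whole boundary of a closed convex subset
of three-space with non-empty interior, with a regular `C²` parametrization near every point. -/
structure IsConvexC2Surface (M : Set E3) : Prop where
  convex : ∃ S : Set E3, IsClosed S ∧ Convex ℝ S ∧ (interior S).Nonempty ∧ M = frontier S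
  charts : ∀ p ∈ M, ∃ X U, IsChart M X U ∧ p ∈ X '' U

/-- The Gaussian curvature of `M` is everywhere at least `K₁`. -/
def CurvatureBoundedBelow (M : Set E3) (K₁ : ℝ) : Prop :=
  ∀ X U, IsChart M X U → ∀ u ∈ U, K₁ ≤ gaussCurvature X u

/-- The tangent plane `T_p M` (a plane through the origin): velocities of curves in `M` through
`p`. -/
def tangentPlane (M : Set E3) (p : E3) : Set E3 :=
  {v | ∃ c : ℝ → E3, c 0 = p ∧ (∀ᶠ t in 𝓝 0, c t ∈ M) ∧ HasDerivAt c v 0}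

/-! ### Intrinsic distance, geodesics, exponential map -/

/-- Intrinsic distance: infimum of the lengths of the curves in `M` from `p` to `q`. -/
def intrinsicDist (M : Set E3) (p q : E3) : ℝ≥0∞ :=
  ⨅ (c : ℝ → E3) (_ : ContinuousOn c (Icc 0 1) ∧ MapsTo c (Icc 0 1) M ∧ c 0 = p ∧ c 1 = q),
    eVariationOn c (Icc 0 1)

/-- A (complete) geodesic of `M`: a `C²` curve in `M` whose acceleration is normal to `M`. -/
structure IsGeodesic (M : Set E3) (γ : ℝ → E3) : Prop where
  contDiff : ContDiff ℝ 2 γ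
  mem : ∀ t, γ t ∈ M
  normal : ∀ t, ∀ v ∈ tangentPlane M (γ t), inner ℝ (deriv (deriv γ) t) v = (0 : ℝ)

/-- The unit speed geodesic `γ`, restricted to `[0, l]`, is a shortest arc of `M` from `p` to
`q`. -/
structure IsShortestArc (M : Set E3) (γ : ℝ → E3) (l : ℝ) (p q : E3) : Prop where
  geodesic : IsGeodesic M γ
  unitSpeed : ∀ t, ‖deriv γ t‖ = 1
  length_nonneg : 0 ≤ l
  source : γ 0 = p
  target : γ l = q
  shortest : intrinsicDist M p q = ENNReal.ofReal l

/-- `exp_p v = q`: the geodesic issuing from `p` with velocity `v` is at `q` at time `1`. -/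
def IsExp (M : Set E3) (p v q : E3) : Prop :=
  ∃ γ : ℝ → E3, IsGeodesic M γ ∧ γ 0 = p ∧ deriv γ 0 = v ∧ γ 1 = q

/-- The open ball of radius `r` about the origin of `T_p M`. -/
def tangentBall (M : Set E3) (p : E3) (r : ℝ≥0) : Set E3 :=
  {v | v ∈ tangentPlane M p ∧ ‖v‖ < r}

/-- The exponential map at `p` is a homeomorphism of the ball of radius `r` in `T_p M` onto an
open subset of `M`. -/
def ExpHomeoOnBall (M : Set E3) (p : E3) (r : ℝ≥0) : Prop :=
  ∃ e : E3 → E3,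
    (∀ v ∈ tangentBall M p r, ∀ q, IsExp M p v q ↔ q = e v) ∧
    ContinuousOn e (tangentBall M p r) ∧
    InjOn e (tangentBall M p r) ∧
    ∀ O : Set E3, IsOpen O → ∃ O' : Set E3, IsOpen O' ∧ e '' (O ∩ tangentBall M p r) = O' ∩ M

/-- Injectivity radius of `M` at `p`. -/
def injRadiusAt (M : Set E3) (p : E3) : ℝ≥0∞ :=
  ⨆ (r : ℝ≥0) (_ : ExpHomeoOnBall M p r), (r : ℝ≥0∞)

/-- Injectivity radius of `M`. -/
def injRadius (M : Set E3) : ℝ≥0∞ :=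
  ⨅ p ∈ M, injRadiusAt M p

/-! ### Convex quadrilaterals and weighted Fermat-Torricelli points -/

/-- Interior of `Q` relative to `M`. -/
def relInterior (M Q : Set E3) : Set E3 :=
  {x | x ∈ Q ∧ Q ∈ 𝓝[M] x}

/-- `Q` is a convex geodesic quadrilateral of `M` with the consecutive vertices `V 0, …, V 3`:
a compact set that contains with any two points a shortest arc joining them, and whose boundary in
`M` is the simple closed curve formed by four shortest arcs, from `V i` to `V (i + 1)` (indices
modulo `4`). -/
structure IsConvexQuadrilateral (M : Set E3) (V : Fin 4 → E3) (Q : Set E3) : Prop where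
  subset : Q ⊆ M
  isCompact : IsCompact Q
  convex : ∀ x ∈ Q, ∀ y ∈ Q, ∃ γ l, IsShortestArc M γ l x y ∧ γ '' Icc 0 l ⊆ Q
  boundary : ∃ (σ : Fin 4 → ℝ → E3) (len : Fin 4 → ℝ),
    (∀ i, IsShortestArc M (σ i) (len i) (V i) (V (i + 1))) ∧
    (∀ i, σ i '' Icc 0 (len i) ∩ σ (i + 1) '' Icc 0 (len (i + 1)) = {V (i + 1)}) ∧
    (∀ i, Disjoint (σ i '' Icc 0 (len i)) (σ (i + 2) '' Icc 0 (len (i + 2)))) ∧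
    Q \ relInterior M Q = ⋃ i, σ i '' Icc 0 (len i)

/-- Perimeter of the quadrilateral with vertices `V`. -/
def perimeter (M : Set E3) (V : Fin 4 → E3) : ℝ≥0∞ :=
  ∑ i, intrinsicDist M (V i) (V (i + 1))

/-- `P` minimizes on `M` the weighted sum of the distances to the vertices. -/
def IsFermatTorricelliPoint (M : Set E3) (V : Fin 4 → E3) (w : Fin 4 → ℝ) (P : E3) : Prop :=
  P ∈ M ∧ ∀ x ∈ M,
    ∑ i, ENNReal.ofReal (w i) * intrinsicDist M P (V i) ≤
      ∑ i, ENNReal.ofReal (w i) * intrinsicDist M x (V i)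

/-- `v = exp_P⁻¹(R)` for the point `R = γ w` at arc length `w` on the unit speed geodesic `γ`
from `P`: the vector `v ∈ T_P M` has length `w`, its exponential is `R`, the segment from `0` to
`v` is mapped by `exp_P` to the arc of `γ` from `P` to `R`, and if `w` is less than the injectivity
radius at `P`, then `v` is the only vector shorter than that radius with exponential `R`. -/
structure IsExpInverse (M : Set E3) (P : E3) (γ : ℝ → E3) (w : ℝ) (v : E3) : Prop where
  mem : v ∈ tangentPlane M P
  norm_eq : ‖v‖ = w
  exp_eq : IsExp M P v (γ w)
  exp_segment : ∀ s ∈ Icc (0 : ℝ) 1, IsExp M P (s • v) (γ (s * w))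
  unique : ENNReal.ofReal w < injRadiusAt M P →
    ∀ v' ∈ tangentPlane M P, ENNReal.ofReal ‖v'‖ < injRadiusAt M P →
      IsExp M P v' (γ w) → v' = v

/-- The points `a, b, c, d` are, in this order, the vertices of a non-degenerate parallelogram. -/
def IsParallelogram (a b c d : E3) : Prop :=
  b - a = c - d ∧ AffineIndependent ℝ ![a, b, d]

end ConvexSurface

end

open ConvexSurface

open ConvexSurface

namespace ConvexSurface

/-! ### The intrinsic distance -/

/-! Let `u i` be the unit initial direction at `P` of the shortest arc to `V i`. Minimality of `P`
forces `∑ w i • u i = 0` (`sum_smul_deriv_eq_zero`), and this balance says exactly that `-(w 0 • u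
0)`, `w 1 • u 1`, `-(w 2 • u 2)`, `w 3 • u 3` have equal opposite sides. The real content is
non-degeneracy.

If the parallelogram were flat, some non-zero linear functional would take the values `c, -c, c, -c`
on the vectors `w i • u i`. But the `u i` lie on a circle in cyclic order, so the diagonals of the
quadrilateral they form cross: a positive combination of `u 0, u 2` equals a positive combination of
`u 1, u 3`. The functional would have opposite signs on the two, so `c = 0`. It then vanishes at
three non-collinear points, hence identically (`eq_zero_of_signedArea`).

Cyclic order comes from the sides. The direction from `P` to a boundary point is a continuous
injective function of that point (`exists_direction`), so each side is seen as a path on the unit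
circle avoiding the directions of the opposite vertices; its ends therefore lie on one side of the
opposite chord (`signedArea_mul_pos_of_path`).

Continuity and injectivity require the boundary to be closer to `P` than the injectivity radius. Two
boundary points are at most half a perimeter apart, and geodesic convexity propagates such a bound
from the boundary to all of `Q` (`IsGeodesicallyConvex.intrinsicDist_lt`). -/

lemma intrinsicDist_comm_le (M : Set E3) (p q : E3) : intrinsicDist M q p ≤ intrinsicDist M p q := by
  refine le_iInf₂ fun c hc => ?_
  obtain ⟨hcont, hmaps, h0, h1⟩ := hc
  have hm : MapsTo (fun t : ℝ => 1 - t) (Icc 0 1) (Icc 0 1) := fun t ht =>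
    ⟨by linarith [ht.2], by linarith [ht.1]⟩
  have hanti : AntitoneOn (fun t : ℝ => 1 - t) (Icc 0 1) := fun s _ t _ hst => by
    simp only; linarith
  refine (iInf₂_le (c ∘ fun t => 1 - t) ⟨hcont.comp (by fun_prop) hm, hmaps.comp hm, by simp [h1],
    by simp [h0]⟩).trans ?_
  exact eVariationOn.comp_le_of_antitoneOn c _ hanti hm

lemma intrinsicDist_comm (M : Set E3) (p q : E3) : intrinsicDist M p q = intrinsicDist M q p :=
  le_antisymm (intrinsicDist_comm_le M q p) (intrinsicDist_comm_le M p q)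

lemma intrinsicDist_triangle (M : Set E3) (p q r : E3) :
    intrinsicDist M p r ≤ intrinsicDist M p q + intrinsicDist M q r := by
  conv_rhs => unfold intrinsicDist
  refine ENNReal.le_iInf₂_add_iInf₂ ?_
  rintro c ⟨hc, hcm, hc0, hc1⟩ e ⟨he, hem, he0, he1⟩
  set f : ℝ → E3 := fun t => if t ≤ 1 / 2 then c (2 * t) else e (2 * t - 1) with hf
  have hf1 : EqOn f (c ∘ fun t => 2 * t) (Icc 0 (1 / 2)) := fun t ht => by
    simp only [hf, Function.comp]; rw [if_pos ht.2]
  have hf2 : EqOn f (e ∘ fun t => 2 * t - 1) (Icc (1 / 2) 1) := fun t ht => by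
    simp only [hf, Function.comp]
    split_ifs with h
    · obtain rfl : t = 1 / 2 := le_antisymm h ht.1
      norm_num [hc1, he0]
    · rfl
  have hm1 : MapsTo (fun t : ℝ => 2 * t) (Icc 0 (1 / 2)) (Icc 0 1) := fun t ht =>
    ⟨by linarith [ht.1], by linarith [ht.2]⟩
  have hm2 : MapsTo (fun t : ℝ => 2 * t - 1) (Icc (1 / 2) 1) (Icc 0 1) := fun t ht =>
    ⟨by linarith [ht.1], by linarith [ht.2]⟩
  have hu : Icc (0 : ℝ) 1 = Icc 0 (1 / 2) ∪ Icc (1 / 2) 1 :=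
    (Icc_union_Icc_eq_Icc (by norm_num) (by norm_num)).symm
  have hfc : ContinuousOn f (Icc 0 1) := by
    rw [hu]
    exact ((hc.comp (by fun_prop) hm1).congr hf1).union_of_isClosed
      ((he.comp (by fun_prop) hm2).congr hf2) isClosed_Icc isClosed_Icc
  have hfm : MapsTo f (Icc 0 1) M := by
    rw [hu]
    exact ((hcm.comp hm1).congr hf1.symm).union ((hem.comp hm2).congr hf2.symm)
  have hf0 : f 0 = p := by simp [hf, hc0]
  have hf1' : f 1 = r := by norm_num [hf, he1]
  refine (iInf₂_le f ⟨hfc, hfm, hf0, hf1'⟩).trans ?_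
  have hsplit := eVariationOn.Icc_add_Icc f (s := univ) (a := 0) (b := 1 / 2) (c := 1)
    (by norm_num) (by norm_num) (mem_univ _)
  simp only [univ_inter] at hsplit
  rw [← hsplit, eVariationOn.eq_of_eqOn hf1, eVariationOn.eq_of_eqOn hf2]
  refine add_le_add (eVariationOn.comp_le_of_monotoneOn c _ ?_ hm1)
    (eVariationOn.comp_le_of_monotoneOn e _ ?_ hm2)
  · intro s _ t _ h; simp only; linarith
  · intro s _ t _ h; simp only; linarith

/-- A `K`-Lipschitz path in `M` over `[a, b]` has length at most `K * (b - a)`. -/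
lemma intrinsicDist_le_of_lipschitz {M : Set E3} {c : ℝ → E3} {a b K : ℝ} (hab : a ≤ b)
    (hK : 0 ≤ K) (hm : MapsTo c (Icc a b) M)
    (hc : ∀ s ∈ Icc a b, ∀ t ∈ Icc a b, ‖c s - c t‖ ≤ K * |s - t|) :
    intrinsicDist M (c a) (c b) ≤ ENNReal.ofReal (K * (b - a)) := by
  have hmaps : MapsTo (fun t : ℝ => a + t * (b - a)) (Icc 0 1) (Icc a b) := fun t ht =>
    ⟨by nlinarith [ht.1, ht.2], by nlinarith [ht.1, ht.2]⟩
  have hlip : LipschitzOnWith (Real.toNNReal (K * (b - a))) (c ∘ fun t => a + t * (b - a))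
      (Icc 0 1) := by
    refine LipschitzOnWith.of_dist_le_mul fun s hs t ht => ?_
    rw [dist_eq_norm, Real.coe_toNNReal _ (mul_nonneg hK (sub_nonneg.2 hab)), Real.dist_eq]
    refine (hc _ (hmaps hs) _ (hmaps ht)).trans (le_of_eq ?_)
    rw [show a + s * (b - a) - (a + t * (b - a)) = (b - a) * (s - t) by ring, abs_mul,
      abs_of_nonneg (sub_nonneg.2 hab)]
    ring
  refine (iInf₂_le (c ∘ fun t => a + t * (b - a)) ⟨hlip.continuousOn, hm.comp hmaps, by simp,
    by simp⟩).trans ?_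
  refine (hlip.comp_eVariationOn_le (g := id) (mapsTo_id _)).trans ?_
  simp [ENNReal.ofReal]

/-! ### Charts, tangent planes and the distance in the small -/

lemma IsChart.hasStrictFDerivAt {M : Set E3} {X : E2 → E3} {U : Set E2} (h : IsChart M X U)
    {u : E2} (hu : u ∈ U) : HasStrictFDerivAt X (fderiv ℝ X u) u :=
  (h.contDiffOn.contDiffAt (h.isOpen.mem_nhds hu)).hasStrictFDerivAt (by norm_num)

lemma IsChart.exists_bound {M : Set E3} {X : E2 → E3} {U : Set E2} (h : IsChart M X U)
    {u : E2} (hu : u ∈ U) : ∃ m > 0, ∀ z, m * ‖z‖ ≤ ‖fderiv ℝ X u z‖ := by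
  obtain ⟨K, hK, hL⟩ := LinearMap.exists_antilipschitzWith (fderiv ℝ X u : E2 →ₗ[ℝ] E3)
    (LinearMap.ker_eq_bot.2 (h.immersion u hu))
  refine ⟨(K : ℝ)⁻¹, by positivity, fun z => ?_⟩
  have := hL.le_mul_dist z 0
  simp only [dist_zero_right, map_zero] at this
  rw [inv_mul_le_iff₀ (by exact_mod_cast hK)]
  exact this

/-- Near a point a chart is as close as we like to its linear part. -/
lemma IsChart.exists_approx {M : Set E3} {X : E2 → E3} {U : Set E2} (h : IsChart M X U)
    {u : E2} (hu : u ∈ U) {η : ℝ} (hη : 0 < η) :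
    ∃ δ > 0, Metric.ball u δ ⊆ U ∧ ∀ a ∈ Metric.ball u δ, ∀ b ∈ Metric.ball u δ,
      ‖X a - X b - fderiv ℝ X u (a - b)‖ ≤ η * ‖a - b‖ := by
  obtain ⟨r, hr, hrX⟩ := Metric.eventually_nhds_iff_ball.1
    ((h.hasStrictFDerivAt hu).isLittleO.def hη)
  obtain ⟨s, hs, hsU⟩ := Metric.isOpen_iff.1 h.isOpen u hu
  refine ⟨min r s, lt_min hr hs, (Metric.ball_subset_ball (min_le_right _ _)).trans hsU,
    fun a ha b hb => hrX (a, b) ?_⟩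
  rw [← ball_prod_same]
  exact ⟨Metric.ball_subset_ball (min_le_left _ _) ha, Metric.ball_subset_ball (min_le_left _ _) hb⟩

lemma IsChart.mem_of_mem {M : Set E3} {X : E2 → E3} {U : Set E2} (h : IsChart M X U)
    {u : E2} (hu : u ∈ U) : X u ∈ M := by
  obtain ⟨O, -, hO⟩ := h.isOpenMap U subset_rfl h.isOpen
  exact (hO ▸ mem_image_of_mem X hu : X u ∈ O ∩ M).2

lemma IsChart.exists_ball_subset_image {M : Set E3} {X : E2 → E3} {U : Set E2} (h : IsChart M X U)
    {u : E2} {δ : ℝ} (hδ : 0 < δ) (hsub : Metric.ball u δ ⊆ U) :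
    ∃ r > 0, ∀ x ∈ M, dist x (X u) < r → ∃ a ∈ Metric.ball u δ, X a = x := by
  obtain ⟨O, hO, hOe⟩ := h.isOpenMap _ hsub Metric.isOpen_ball
  have hmem : X u ∈ O ∩ M := hOe ▸ mem_image_of_mem X (Metric.mem_ball_self hδ)
  obtain ⟨r, hr, hrO⟩ := Metric.isOpen_iff.1 hO _ hmem.1
  refine ⟨r, hr, fun x hx hxr => ?_⟩
  have : x ∈ X '' Metric.ball u δ := hOe ▸ ⟨hrO hxr, hx⟩
  exact this

/-- A curve in `M` need not be known to lift to a differentiable curve in the parameter plane. It is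
enough that its difference quotients are approximated by vectors of the range of the differential,
since that range is closed. -/
lemma IsChart.tangentPlane_eq {M : Set E3} {X : E2 → E3} {U : Set E2} (h : IsChart M X U)
    {u : E2} (hu : u ∈ U) :
    tangentPlane M (X u) = LinearMap.range (fderiv ℝ X u : E2 →ₗ[ℝ] E3) := by
  ext v
  constructor
  · rintro ⟨c, hc0, hcM, hc⟩
    have hcl : IsClosed (LinearMap.range (fderiv ℝ X u : E2 →ₗ[ℝ] E3) : Set E3) :=
      Submodule.closed_of_finiteDimensional _
    rw [← hcl.closure_eq, Metric.mem_closure_iff]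
    intro ε hε
    obtain ⟨m, hm, hmb⟩ := h.exists_bound hu
    -- The first bound keeps the chart bi-Lipschitz, giving `‖a - u‖ ≤ 2 / m * ‖c t - X u‖`; the
    -- second makes the resulting linearization error, divided by `|t|`, less than `ε / 2`.
    set η := min (m / 2) (m * ε / (4 * (‖v‖ + 1 + ε))) with hηd
    have hη : 0 < η := by positivity
    have hη1 : η ≤ m / 2 := min_le_left _ _
    have hη2 : η * (2 / m * (‖v‖ + ε)) < ε / 2 := by
      have : η ≤ m * ε / (4 * (‖v‖ + 1 + ε)) := min_le_right _ _
      rw [le_div_iff₀ (by positivity)] at this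
      rw [show η * (2 / m * (‖v‖ + ε)) = η * (2 * (‖v‖ + ε)) / m by ring, div_lt_iff₀ hm]
      nlinarith [norm_nonneg v]
    obtain ⟨δ, hδ, hsub, happ⟩ := h.exists_approx hu hη
    obtain ⟨r, hr, hrX⟩ := h.exists_ball_subset_image hδ hsub
    have hnear : ∀ᶠ t in 𝓝 (0 : ℝ), dist (c t) (X u) < r := by
      have := hc.continuousAt.eventually (Metric.ball_mem_nhds (c 0) hr)
      rwa [hc0] at this
    have hslope := (hasDerivAt_iff_tendsto_slope_zero.1 hc).eventually
      (Metric.ball_mem_nhds v (half_pos hε))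
    obtain ⟨t, ⟨htr, htM⟩, htv, ht0⟩ := ((((hnear.and hcM).filter_mono nhdsWithin_le_nhds).and
      (hslope.and self_mem_nhdsWithin)) : ∀ᶠ t in 𝓝[≠] (0 : ℝ), _).exists
    obtain ⟨a, ha, hax⟩ := hrX _ htM htr
    have ht0' : t ≠ 0 := ht0
    have htp : 0 < |t| := abs_pos.2 ht0'
    refine ⟨t⁻¹ • fderiv ℝ X u (a - u), ⟨t⁻¹ • (a - u), by simp⟩, ?_⟩
    have h1 := happ a ha u (Metric.mem_ball_self hδ)
    have h2 := hmb (a - u)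
    simp only [zero_add, dist_eq_norm] at htv
    rw [hax] at h1
    rw [hc0] at htv
    have h3 : ‖fderiv ℝ X u (a - u)‖ ≤ ‖c t - X u‖ + η * ‖a - u‖ := by
      have := norm_sub_norm_le (fderiv ℝ X u (a - u)) (c t - X u)
      rw [norm_sub_rev (fderiv ℝ X u (a - u))] at this
      linarith
    have h4 : ‖a - u‖ ≤ 2 / m * ‖c t - X u‖ := by
      rw [div_mul_eq_mul_div, le_div_iff₀ hm]
      nlinarith [norm_nonneg (a - u)]
    have h5 : ‖c t - X u‖ ≤ |t| * (‖v‖ + ε) := by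
      have : ‖t⁻¹ • (c t - X u)‖ ≤ ‖v‖ + ε := by
        have := norm_sub_norm_le (t⁻¹ • (c t - X u)) v
        linarith
      rwa [norm_smul, norm_inv, Real.norm_eq_abs, inv_mul_le_iff₀ htp] at this
    have h6 : ‖t⁻¹ • (c t - X u) - t⁻¹ • fderiv ℝ X u (a - u)‖ < ε / 2 := by
      rw [← smul_sub, norm_smul, norm_inv, Real.norm_eq_abs, inv_mul_lt_iff₀ htp]
      refine h1.trans_lt ?_
      calc η * ‖a - u‖ ≤ η * (2 / m * (|t| * (‖v‖ + ε))) := by gcongr; exact h4.trans (by gcongr)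
        _ = |t| * (η * (2 / m * (‖v‖ + ε))) := by ring
        _ < |t| * (ε / 2) := by gcongr
    rw [dist_eq_norm]
    calc ‖v - t⁻¹ • fderiv ℝ X u (a - u)‖
        = ‖(t⁻¹ • (c t - X u) - t⁻¹ • fderiv ℝ X u (a - u)) - (t⁻¹ • (c t - X u) - v)‖ := by
          congr 1; abel
      _ ≤ _ := norm_sub_le _ _
      _ < ε / 2 + ε / 2 := add_lt_add h6 htv
      _ = ε := add_halves ε
  · rintro ⟨a, rfl⟩
    have hline : HasDerivAt (fun t : ℝ => u + t • a) a 0 := by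
      simpa using ((hasDerivAt_id (0 : ℝ)).smul_const a).const_add u
    refine ⟨fun t => X (u + t • a), by simp, ?_, ?_⟩
    · have : ∀ᶠ t in 𝓝 (0 : ℝ), u + t • a ∈ U :=
        hline.continuousAt.eventually (by simpa using h.isOpen.mem_nhds hu)
      exact this.mono fun t ht => h.mem_of_mem ht
    · have := (h.hasStrictFDerivAt hu).hasFDerivAt
      rw [show u = u + (0 : ℝ) • a by simp] at this
      have h2 := this.comp_hasDerivAt (0 : ℝ) hline
      simp only [zero_smul, add_zero] at h2
      exact h2

/-- The tangent plane of a surface is a plane. -/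
lemma exists_submodule_eq_tangentPlane {M : Set E3} (hM : IsConvexC2Surface M) {p : E3}
    (hp : p ∈ M) :
    ∃ T : Submodule ℝ E3, Module.finrank ℝ T = 2 ∧ (T : Set E3) = tangentPlane M p := by
  obtain ⟨X, U, hX, u, hu, rfl⟩ := hM.charts p hp
  refine ⟨_, ?_, (hX.tangentPlane_eq hu).symm⟩
  rw [LinearMap.finrank_range_of_inj (hX.immersion u hu)]
  simp

/-- In the small the intrinsic distance is almost the distance in space. -/
lemma exists_intrinsicDist_le {M : Set E3} (hM : IsConvexC2Surface M) {p : E3}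
    (hp : p ∈ M) {ε : ℝ} (hε : 0 < ε) :
    ∃ δ > 0, ∀ x ∈ M, ∀ y ∈ M, dist x p < δ → dist y p < δ →
      intrinsicDist M x y ≤ ENNReal.ofReal ((1 + ε) * ‖x - y‖) := by
  obtain ⟨X, U, hX, u, hu, rfl⟩ := hM.charts p hp
  obtain ⟨m, hm, hmb⟩ := hX.exists_bound hu
  -- The image of the coordinate segment has length at most `‖X b - X a‖ + 2 * η * ‖b - a‖`, while
  -- `(m - η) * ‖b - a‖ ≤ ‖X b - X a‖`. This `η` solves `2 * η = ε * (m - η)`.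
  set η := m * ε / (2 + ε) with hηd
  have hη : 0 < η := by positivity
  have hηm : η * (2 + ε) = m * ε := by rw [hηd]; field_simp
  obtain ⟨δ, hδ, hsub, happ⟩ := hX.exists_approx hu hη
  obtain ⟨r, hr, hrX⟩ := hX.exists_ball_subset_image hδ hsub
  refine ⟨r, hr, fun x hx y hy hxr hyr => ?_⟩
  obtain ⟨a, ha, rfl⟩ := hrX x hx hxr
  obtain ⟨b, hb, rfl⟩ := hrX y hy hyr
  have hseg : ∀ t ∈ Icc (0 : ℝ) 1, a + t • (b - a) ∈ Metric.ball u δ := fun t ht =>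
    (convex_ball u δ).add_smul_sub_mem ha hb ht
  set L := fderiv ℝ X u with hL
  have hdist := intrinsicDist_le_of_lipschitz (M := M) (c := fun t => X (a + t • (b - a)))
    (a := 0) (b := 1) (K := ‖L (b - a)‖ + η * ‖b - a‖) zero_le_one (by positivity)
    (fun t ht => hX.mem_of_mem (hsub (hseg t ht))) (fun s hs t ht => by
      have h1 := happ _ (hseg s hs) _ (hseg t ht)
      have h2 : a + s • (b - a) - (a + t • (b - a)) = (s - t) • (b - a) := by
        rw [sub_smul]; abel
      rw [h2, map_smul, norm_smul, Real.norm_eq_abs] at h1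
      have h3 := norm_sub_norm_le (X (a + s • (b - a)) - X (a + t • (b - a))) ((s - t) • L (b - a))
      rw [norm_smul, Real.norm_eq_abs] at h3
      linarith)
  simp only [zero_smul, add_zero, one_smul, add_sub_cancel, sub_zero, mul_one] at hdist
  refine hdist.trans (ENNReal.ofReal_le_ofReal ?_)
  have h1 := happ b hb a ha
  have h2 := hmb (b - a)
  have h3 := norm_sub_norm_le (L (b - a)) (X b - X a)
  rw [norm_sub_rev (L (b - a))] at h3
  rw [norm_sub_rev (X a)]
  have h4 : 2 * (η * ‖b - a‖) ≤ ε * ‖X b - X a‖ := by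
    have : (m - η) * ‖b - a‖ ≤ ‖X b - X a‖ := by nlinarith
    nlinarith [mul_le_mul_of_nonneg_left this hε.le, norm_nonneg (b - a)]
  linarith

/-! ### Geodesics -/

lemma IsGeodesic.hasDerivAt {M : Set E3} {γ : ℝ → E3} (h : IsGeodesic M γ) (t : ℝ) :
    HasDerivAt γ (deriv γ t) t :=
  (h.contDiff.differentiable (by norm_num) t).hasDerivAt

lemma IsGeodesic.hasDerivAt_deriv {M : Set E3} {γ : ℝ → E3} (h : IsGeodesic M γ) (t : ℝ) :
    HasDerivAt (deriv γ) (deriv (deriv γ) t) t :=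
  (((contDiff_succ_iff_deriv (n := 1)).1 h.contDiff).2.2.differentiable (by norm_num) t).hasDerivAt

lemma IsGeodesic.deriv_affine {M : Set E3} {γ : ℝ → E3} (h : IsGeodesic M γ) (a c : ℝ) :
    deriv (fun t => γ (a + c * t)) = fun t => c • deriv γ (a + c * t) := by
  funext t
  have h1 : HasDerivAt (fun t : ℝ => a + c * t) c t := by
    simpa using ((hasDerivAt_id t).const_mul c).const_add a
  exact ((h.hasDerivAt (a + c * t)).scomp t h1).deriv

lemma IsGeodesic.affine {M : Set E3} {γ : ℝ → E3} (h : IsGeodesic M γ) (a c : ℝ) :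
    IsGeodesic M (fun t => γ (a + c * t)) where
  contDiff := h.contDiff.comp (by fun_prop)
  mem t := h.mem _
  normal t v hv := by
    have h1 : HasDerivAt (fun t : ℝ => a + c * t) c t := by
      simpa using ((hasDerivAt_id t).const_mul c).const_add a
    have h2 := (((h.hasDerivAt_deriv (a + c * t)).scomp t h1).const_smul c).deriv
    rw [h.deriv_affine, show (fun t => c • deriv γ (a + c * t))
      = c • (deriv γ ∘ fun t => a + c * t) from rfl, h2, inner_smul_left, inner_smul_left,
      h.normal _ v hv]
    simp

lemma IsGeodesic.deriv_mem {M : Set E3} {γ : ℝ → E3} (h : IsGeodesic M γ) (t : ℝ) :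
    deriv γ t ∈ tangentPlane M (γ t) := by
  refine ⟨fun s => γ (t + 1 * s), by simp, .of_forall fun s => h.mem _, ?_⟩
  have h1 := (h.affine t 1).hasDerivAt 0
  rw [h.deriv_affine] at h1
  simpa using h1

/-- The acceleration is normal to `M` and the velocity is tangent, so `‖deriv γ‖ ^ 2` has derivative
zero. -/
lemma IsGeodesic.norm_deriv_eq {M : Set E3} {γ : ℝ → E3} (h : IsGeodesic M γ) (t : ℝ) :
    ‖deriv γ t‖ = ‖deriv γ 0‖ := by
  have h1 : ∀ s, HasDerivAt (fun s => ‖deriv γ s‖ ^ 2) 0 s := fun s => by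
    have := (h.hasDerivAt_deriv s).norm_sq
    rwa [real_inner_comm, h.normal s _ (h.deriv_mem s), mul_zero] at this
  have h2 : ‖deriv γ t‖ ^ 2 = ‖deriv γ 0‖ ^ 2 :=
    is_const_of_deriv_eq_zero (fun s => (h1 s).differentiableAt) (fun s => (h1 s).deriv) t 0
  exact (sq_eq_sq₀ (norm_nonneg _) (norm_nonneg _)).1 h2

lemma IsGeodesic.intrinsicDist_le {M : Set E3} {γ : ℝ → E3} (h : IsGeodesic M γ) {s t : ℝ}
    (hst : s ≤ t) :
    intrinsicDist M (γ s) (γ t) ≤ ENNReal.ofReal (‖deriv γ 0‖ * (t - s)) :=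
  intrinsicDist_le_of_lipschitz hst (norm_nonneg _) (fun t _ => h.mem t) fun a _ b _ => by
    simpa [Real.norm_eq_abs] using convex_univ.norm_image_sub_le_of_norm_deriv_le (f := γ)
      (fun x _ => (h.hasDerivAt x).differentiableAt) (fun x _ => (h.norm_deriv_eq x).le)
      (mem_univ b) (mem_univ a)

lemma IsShortestArc.intrinsicDist_le {M : Set E3} {γ : ℝ → E3} {l : ℝ} {p q : E3}
    (h : IsShortestArc M γ l p q) {s t : ℝ} (hst : s ≤ t) :
    intrinsicDist M (γ s) (γ t) ≤ ENNReal.ofReal (t - s) := by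
  simpa [h.unitSpeed] using h.geodesic.intrinsicDist_le hst

lemma IsShortestArc.continuous {M : Set E3} {γ : ℝ → E3} {l : ℝ} {p q : E3}
    (h : IsShortestArc M γ l p q) : Continuous γ := h.geodesic.contDiff.continuous

lemma IsShortestArc.reverse {M : Set E3} {γ : ℝ → E3} {l : ℝ} {p q : E3}
    (h : IsShortestArc M γ l p q) : IsShortestArc M (fun t => γ (l + (-1) * t)) l q p where
  geodesic := h.geodesic.affine _ _
  unitSpeed t := by rw [h.geodesic.deriv_affine]; simp [h.unitSpeed]
  length_nonneg := h.length_nonneg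
  source := by simp [h.target]
  target := by simp [h.source]
  shortest := by rw [intrinsicDist_comm, h.shortest]

/-! ### The exponential map within the injectivity radius -/

/-- `e` is the exponential map at `p` on the ball of radius `r`, and is a homeomorphism of this
ball onto an open subset of `M`. -/
structure IsExpHomeo (M : Set E3) (p : E3) (r : ℝ≥0) (e : E3 → E3) : Prop where
  exp : ∀ v ∈ tangentBall M p r, ∀ q, IsExp M p v q ↔ q = e v
  continuousOn : ContinuousOn e (tangentBall M p r)
  injOn : InjOn e (tangentBall M p r)
  isOpenMap : ∀ O : Set E3, IsOpen O →
    ∃ O' : Set E3, IsOpen O' ∧ e '' (O ∩ tangentBall M p r) = O' ∩ M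

lemma tangentBall_mono {M : Set E3} {p : E3} {r s : ℝ≥0} (h : r ≤ s) :
    tangentBall M p r ⊆ tangentBall M p s :=
  fun _ hv => ⟨hv.1, hv.2.trans_le (by exact_mod_cast h)⟩

lemma IsExpHomeo.mono {M : Set E3} {p : E3} {r s : ℝ≥0} {e : E3 → E3} (h : IsExpHomeo M p s e)
    (hrs : r ≤ s) : IsExpHomeo M p r e where
  exp v hv := h.exp v (tangentBall_mono hrs hv)
  continuousOn := h.continuousOn.mono (tangentBall_mono hrs)
  injOn := h.injOn.mono (tangentBall_mono hrs)
  isOpenMap O hO := by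
    obtain ⟨O', hO', h'⟩ := h.isOpenMap (O ∩ Metric.ball 0 r) (hO.inter Metric.isOpen_ball)
    refine ⟨O', hO', ?_⟩
    rw [← h']
    congr 1
    ext v
    have : (r : ℝ) ≤ s := by exact_mod_cast hrs
    simp only [tangentBall, mem_inter_iff, mem_ofPred_eq, Metric.mem_ball, dist_zero_right]
    constructor
    · rintro ⟨h1, h2, h3⟩
      exact ⟨⟨h1, h3⟩, h2, h3.trans_le this⟩
    · rintro ⟨⟨h1, h3⟩, h2, -⟩
      exact ⟨h1, h2, h3⟩

lemma exists_isExpHomeo_of_lt_injRadiusAt {M : Set E3} {p : E3} {r : ℝ≥0}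
    (h : (r : ℝ≥0∞) < injRadiusAt M p) : ∃ e, IsExpHomeo M p r e := by
  obtain ⟨s, hs⟩ := lt_iSup_iff.1 h
  obtain ⟨⟨e, h1, h2, h3, h4⟩, hrs⟩ := lt_iSup_iff.1 hs
  exact ⟨e, IsExpHomeo.mono ⟨h1, h2, h3, h4⟩ (by exact_mod_cast hrs.le)⟩

lemma exists_isExpHomeo_of_lt_injRadius {M : Set E3} {p : E3} (hp : p ∈ M) {r : ℝ≥0}
    (h : (r : ℝ≥0∞) < injRadius M) : ∃ e, IsExpHomeo M p r e :=
  exists_isExpHomeo_of_lt_injRadiusAt (h.trans_le (iInf₂_le p hp))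

lemma smul_mem_tangentPlane {M : Set E3} {p v : E3} (hv : v ∈ tangentPlane M p) (s : ℝ) :
    s • v ∈ tangentPlane M p := by
  obtain ⟨c, h0, hc, hd⟩ := hv
  have hs : HasDerivAt (fun t : ℝ => s * t) s 0 := by
    simpa using (hasDerivAt_id (0 : ℝ)).const_mul s
  have h0' : s * (0 : ℝ) = 0 := mul_zero s
  refine ⟨fun t => c (s * t), by simp [h0], ?_, ?_⟩
  · have : Tendsto (fun t : ℝ => s * t) (𝓝 0) (𝓝 0) := by
      simpa using hs.continuousAt.tendsto
    exact this.eventually hc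
  · rw [← h0'] at hd
    exact hd.scomp (0 : ℝ) hs

lemma smul_mem_tangentBall {M : Set E3} {p v : E3} {r : ℝ≥0} (hv : v ∈ tangentBall M p r) {s : ℝ}
    (hs : s ∈ Icc (0 : ℝ) 1) : s • v ∈ tangentBall M p r := by
  refine ⟨smul_mem_tangentPlane hv.1 s, lt_of_le_of_lt ?_ hv.2⟩
  rw [norm_smul, Real.norm_eq_abs, abs_of_nonneg hs.1]
  exact mul_le_of_le_one_left (norm_nonneg _) hs.2

/-- The geodesic `s ↦ γ (t * s)` has initial velocity `t • deriv γ 0` and is at `γ t` at time `1`.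
The uniqueness in the field `exp` then identifies `γ t`, with no separate appeal to uniqueness for
the geodesic equation. -/
lemma IsExpHomeo.apply_smul_deriv {M : Set E3} {p : E3} {r : ℝ≥0} {e : E3 → E3}
    (h : IsExpHomeo M p r e) {γ : ℝ → E3} (hγ : IsGeodesic M γ) (h0 : γ 0 = p) {t : ℝ}
    (ht : ‖t • deriv γ 0‖ < r) : e (t • deriv γ 0) = γ t := by
  have hmem : t • deriv γ 0 ∈ tangentBall M p r :=
    ⟨smul_mem_tangentPlane (h0 ▸ hγ.deriv_mem 0) t, ht⟩
  refine ((h.exp _ hmem (γ t)).1 ⟨_, hγ.affine 0 t, by simpa using h0, ?_, by simp⟩).symm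
  rw [hγ.deriv_affine]
  simp

lemma IsExpHomeo.exists_geodesic {M : Set E3} {p : E3} {r : ℝ≥0} {e : E3 → E3}
    (h : IsExpHomeo M p r e) {v : E3} (hv : v ∈ tangentBall M p r) :
    ∃ γ, IsGeodesic M γ ∧ γ 0 = p ∧ deriv γ 0 = v ∧ ∀ s ∈ Icc (0 : ℝ) 1, γ s = e (s • v) := by
  obtain ⟨γ, hγ, h0, hd, -⟩ := (h.exp v hv (e v)).2 rfl
  refine ⟨γ, hγ, h0, hd, fun s hs => ?_⟩
  rw [← hd]
  exact (h.apply_smul_deriv hγ h0 (hd ▸ (smul_mem_tangentBall hv hs).2)).symm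

lemma IsExpHomeo.apply_zero {M : Set E3} {p : E3} {r : ℝ≥0} {e : E3 → E3}
    (h : IsExpHomeo M p r e) {v : E3} (hv : v ∈ tangentBall M p r) : e 0 = p := by
  obtain ⟨γ, -, h0, -, hs⟩ := h.exists_geodesic hv
  rw [← h0, hs 0 (by simp), zero_smul]

lemma IsExpHomeo.apply_mem {M : Set E3} {p : E3} {r : ℝ≥0} {e : E3 → E3}
    (h : IsExpHomeo M p r e) {v : E3} (hv : v ∈ tangentBall M p r) : e v ∈ M := by
  obtain ⟨γ, hγ, -, -, hs⟩ := h.exists_geodesic hv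
  have := hs 1 (by simp)
  rw [one_smul] at this
  exact this ▸ hγ.mem 1

lemma IsExpHomeo.intrinsicDist_le {M : Set E3} {p : E3} {r : ℝ≥0} {e : E3 → E3}
    (h : IsExpHomeo M p r e) {v : E3} (hv : v ∈ tangentBall M p r) :
    intrinsicDist M p (e v) ≤ ENNReal.ofReal ‖v‖ := by
  obtain ⟨γ, hγ, h0, hd, hs⟩ := h.exists_geodesic hv
  have := hγ.intrinsicDist_le zero_le_one
  rwa [hs 1 (by simp), h0, hd, one_smul, sub_zero, mul_one] at this

lemma IsExpHomeo.apply_arc {M : Set E3} {p q : E3} {r : ℝ≥0} {e : E3 → E3}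
    (h : IsExpHomeo M p r e) {γ : ℝ → E3} {l : ℝ} (hγ : IsShortestArc M γ l p q) {t : ℝ}
    (ht : 0 ≤ t) (htr : t < r) :
    t • deriv γ 0 ∈ tangentBall M p r ∧ e (t • deriv γ 0) = γ t := by
  have hn : ‖t • deriv γ 0‖ < r := by
    rwa [norm_smul, hγ.unitSpeed, Real.norm_eq_abs, abs_of_nonneg ht, mul_one]
  exact ⟨⟨smul_mem_tangentPlane (hγ.source ▸ hγ.geodesic.deriv_mem 0) t, hn⟩,
    h.apply_smul_deriv hγ.geodesic hγ.source hn⟩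

/-! ### Geodesically convex sets -/

/-- `Q` contains with any two points a shortest arc joining them. -/
def IsGeodesicallyConvex (M Q : Set E3) : Prop :=
  ∀ x ∈ Q, ∀ y ∈ Q, ∃ γ l, IsShortestArc M γ l x y ∧ γ '' Icc 0 l ⊆ Q

lemma IsGeodesicallyConvex.isPreconnected {M Q : Set E3} (hQ : IsGeodesicallyConvex M Q) :
    IsPreconnected Q := by
  refine isPreconnected_of_forall_pair fun x hx y hy => ?_
  obtain ⟨γ, l, hγ, hsub⟩ := hQ x hx y hy
  exact ⟨_, hsub, ⟨0, ⟨le_rfl, hγ.length_nonneg⟩, hγ.source⟩, ⟨l, ⟨hγ.length_nonneg, le_rfl⟩,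
    hγ.target⟩, isPreconnected_Icc.image _ hγ.continuous.continuousOn⟩

/-- A point of `Q` within the injectivity radius is the exponential of a vector whose length is its
distance, and the radial geodesic to it stays in `Q`. -/
lemma IsGeodesicallyConvex.exists_vector {M Q : Set E3} (hQ : IsGeodesicallyConvex M Q)
    {p : E3} {r : ℝ≥0} {e : E3 → E3} (he : IsExpHomeo M p r e) (hp : p ∈ Q) {q : E3} (hq : q ∈ Q)
    (hd : intrinsicDist M p q < r) :
    ∃ v ∈ tangentBall M p r, e v = q ∧ intrinsicDist M p q = ENNReal.ofReal ‖v‖ ∧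
      ∀ κ ∈ Icc (0 : ℝ) 1, e (κ • v) ∈ Q := by
  obtain ⟨γ, l, hγ, hsub⟩ := hQ p hp q hq
  have hl : l < r := by
    rw [hγ.shortest, ← ENNReal.ofReal_coe_nnreal] at hd
    exact (ENNReal.ofReal_lt_ofReal_iff_of_nonneg hγ.length_nonneg).1 hd
  obtain ⟨h1, h2⟩ := he.apply_arc hγ hγ.length_nonneg hl
  refine ⟨_, h1, h2.trans hγ.target, ?_, fun κ hκ => ?_⟩
  · rw [hγ.shortest, norm_smul, hγ.unitSpeed, Real.norm_eq_abs, abs_of_nonneg hγ.length_nonneg,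
      mul_one]
  · have h3 : κ * l ≤ l := mul_le_of_le_one_left hγ.length_nonneg hκ.2
    have h4 : 0 ≤ κ * l := mul_nonneg hκ.1 hγ.length_nonneg
    rw [smul_smul, (he.apply_arc hγ h4 (h3.trans_lt hl)).2]
    exact hsub ⟨_, ⟨h4, h3⟩, rfl⟩

/-- `Q` is star-shaped in exponential coordinates about each of its points. -/
lemma IsGeodesicallyConvex.apply_smul_mem {M Q : Set E3} (hQ : IsGeodesicallyConvex M Q)
    {p : E3} {r : ℝ≥0} {e : E3 → E3} (he : IsExpHomeo M p r e) (hp : p ∈ Q) {v : E3}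
    (hv : v ∈ tangentBall M p r) (hev : e v ∈ Q) {κ : ℝ} (hκ : κ ∈ Icc (0 : ℝ) 1) :
    e (κ • v) ∈ Q := by
  have hd : intrinsicDist M p (e v) < r := by
    refine (he.intrinsicDist_le hv).trans_lt ?_
    rw [← ENNReal.ofReal_coe_nnreal, ENNReal.ofReal_lt_ofReal_iff_of_nonneg (norm_nonneg _)]
    exact hv.2
  -- The shortest arc provided by convexity might a priori start along another vector `v'`;
  -- injectivity of `e` gives `v' = v`.
  obtain ⟨v', hv', hev', -, h⟩ := hQ.exists_vector he hp hev hd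
  rw [← he.injOn hv' hv hev']
  exact h κ hκ

/-- Points between `p` and a relative interior point of `Q` are relative interior points. -/
lemma IsGeodesicallyConvex.apply_smul_mem_relInterior {M Q : Set E3}
    (hQ : IsGeodesicallyConvex M Q)
    {p : E3} {r : ℝ≥0} {e : E3 → E3} (he : IsExpHomeo M p r e) (hp : p ∈ Q) {v : E3}
    (hv : v ∈ tangentBall M p r) (hev : e v ∈ relInterior M Q) {κ : ℝ} (hκ0 : 0 < κ)
    (hκ1 : κ ≤ 1) : e (κ • v) ∈ relInterior M Q := by
  refine ⟨hQ.apply_smul_mem he hp hv hev.1 ⟨hκ0.le, hκ1⟩, ?_⟩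
  obtain ⟨O, hO, heO, hOQ⟩ := mem_nhdsWithin.1 hev.2
  obtain ⟨W, hW, hWe⟩ := (continuousOn_iff'.1 he.continuousOn) O hO
  have hsm : Continuous fun x : E3 => κ⁻¹ • x := continuous_const_smul _
  -- The contraction by `κ` in exponential coordinates about `p` carries a neighbourhood of `e v`
  -- lying in `Q` to a neighbourhood of `e (κ • v)`, which lies in `Q` by star-shapedness.
  -- Intersecting with the ball keeps `κ⁻¹ • x` in the domain of `e`.
  obtain ⟨O', hO', himg⟩ := he.isOpenMap ((fun x : E3 => κ⁻¹ • x) ⁻¹' (W ∩ Metric.ball 0 r))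
    ((hW.inter Metric.isOpen_ball).preimage hsm)
  have hvW : v ∈ W := (hWe ▸ (⟨heO, hv⟩ : v ∈ e ⁻¹' O ∩ tangentBall M p r) :
    v ∈ W ∩ tangentBall M p r).1
  have hκv : e (κ • v) ∈ O' ∩ M := by
    rw [← himg]
    refine mem_image_of_mem e ⟨?_, smul_mem_tangentBall hv ⟨hκ0.le, hκ1⟩⟩
    simpa [smul_smul, inv_mul_cancel₀ hκ0.ne', hvW] using hv.2
  refine mem_nhdsWithin.2 ⟨O', hO', hκv.1, ?_⟩
  rw [← himg]
  rintro _ ⟨x, ⟨⟨hxW, hxr⟩, hx⟩, rfl⟩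
  have hx' : κ⁻¹ • x ∈ tangentBall M p r :=
    ⟨smul_mem_tangentPlane hx.1 _, by simpa using hxr⟩
  have hxO : e (κ⁻¹ • x) ∈ O := (hWe.symm ▸ (⟨hxW, hx'⟩ : κ⁻¹ • x ∈ W ∩ tangentBall M p r) :
    κ⁻¹ • x ∈ e ⁻¹' O ∩ tangentBall M p r).1
  have := hQ.apply_smul_mem he hp hx' (hOQ ⟨hxO, he.apply_mem hx'⟩) ⟨hκ0.le, hκ1⟩
  rwa [smul_smul, mul_inv_cancel₀ hκ0.ne', one_smul] at this

/-- A shortest arc of `Q` issuing from a relative interior point meets the relative boundary at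
most at its end. -/
lemma IsGeodesicallyConvex.arc_mem_relInterior {M Q : Set E3} (hQ : IsGeodesicallyConvex M Q)
    {p q : E3} {r : ℝ≥0} {e : E3 → E3} (he : IsExpHomeo M q r e) (hp : p ∈ relInterior M Q)
    (hq : q ∈ Q) {γ : ℝ → E3} {l : ℝ} (hγ : IsShortestArc M γ l p q) (hl : l < r) {s : ℝ}
    (hs : s ∈ Ico 0 l) : γ s ∈ relInterior M Q := by
  have hl0 : 0 < l := hs.1.trans_lt hs.2
  -- The contraction is centred at the end `q`, so the arc is run backwards from `q` to the relative
  -- interior point `p`.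
  obtain ⟨h1, h2⟩ := he.apply_arc hγ.reverse hl0.le hl
  rw [hγ.reverse.target] at h2
  have h3 := hQ.apply_smul_mem_relInterior he hq h1 (h2 ▸ hp) (κ := (l - s) / l)
    (div_pos (sub_pos.2 hs.2) hl0) ((div_le_one hl0).2 (by linarith [hs.1]))
  rw [smul_smul, div_mul_cancel₀ _ hl0.ne',
    (he.apply_arc hγ.reverse (sub_nonneg.2 hs.2.le) (by linarith [hs.1])).2] at h3
  simpa using h3

/-- This replaces the relative interior by an open set of the ambient space, the form in which
preconnectedness is applied. -/
lemma mem_relInterior_iff {M Q : Set E3} {x : E3} (hx : x ∈ M) :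
    x ∈ relInterior M Q ↔ x ∈ interior (Q ∪ Mᶜ) := by
  rw [mem_interior_iff_mem_nhds, relInterior, mem_ofPred_eq, mem_nhdsWithin_iff_eventually]
  constructor
  · rintro ⟨-, h⟩
    filter_upwards [h] with y hy
    by_cases hyM : y ∈ M
    · exact .inl (hy hyM)
    · exact .inr hyM
  · intro h
    exact ⟨(mem_of_mem_nhds h).resolve_right fun h => h hx,
      Filter.mem_of_superset h fun y hy hyM => hy.resolve_right fun h => h hyM⟩

/-- If the relative boundary of `Q` is within distance `ρ` of one of its points, then so is
all of `Q`. -/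
lemma IsGeodesicallyConvex.intrinsicDist_lt {M Q : Set E3} (hM : IsConvexC2Surface M)
    (hQ : IsGeodesicallyConvex M Q) (hQM : Q ⊆ M) (hQc : IsClosed Q)
    {x : E3} {r ρ : ℝ≥0} {e : E3 → E3} (he : IsExpHomeo M x r e) (hx : x ∈ Q \ relInterior M Q)
    (hρ : 0 < ρ) (hρr : ρ < r)
    (hbd : ∀ y ∈ Q \ relInterior M Q, intrinsicDist M x y < ρ) {z : E3} (hz : z ∈ Q) :
    intrinsicDist M x z < ρ := by
  obtain ⟨T, hT2, hT⟩ := exists_submodule_eq_tangentPlane hM (hQM hx.1)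
  have hρr' : (ρ : ℝ) < r := by exact_mod_cast hρr
  have hρ' : (0 : ℝ) < ρ := by exact_mod_cast hρ
  have hball : ∀ v : T, ‖v‖ ≤ ρ → (v : E3) ∈ tangentBall M x r := fun v hv =>
    ⟨hT ▸ v.2, lt_of_le_of_lt hv hρr'⟩
  have hcontT : ContinuousOn (fun v : T => e v) (Metric.closedBall 0 ρ) :=
    he.continuousOn.comp continuous_subtype_val.continuousOn fun v hv => hball v (by simpa using hv)
  have hS : IsPreconnected ((fun v : T => e v) '' Metric.sphere 0 ρ) := by
    refine IsPreconnected.image (isPreconnected_sphere ?_ 0 ρ) _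
      (hcontT.mono Metric.sphere_subset_closedBall)
    rw [← Module.finrank_eq_rank, hT2]
    norm_num
  have h0 : e 0 = x := he.apply_zero (hball 0 (by simp))
  -- A boundary point is the exponential of a vector as long as its distance from `x`, hence shorter
  -- than `ρ`; by injectivity it is not the exponential of a vector of length `ρ`.
  have hnear : ∀ v : T, ‖v‖ = ρ → e v ∉ Q \ relInterior M Q := by
    intro v hv hev
    obtain ⟨v', hv', hev', hd, -⟩ := hQ.exists_vector he hx.1 hev.1
      ((hbd _ hev).trans (by exact_mod_cast hρr))
    have h1 := hbd _ hev
    rw [hd, he.injOn hv' (hball v hv.le) hev', ← ENNReal.ofReal_coe_nnreal,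
      ENNReal.ofReal_lt_ofReal_iff hρ'] at h1
    exact h1.ne hv
  -- The geodesic circle of radius `ρ` is connected and misses the boundary of `Q`, so it lies
  -- inside `Q` or outside it. In the first case star-shapedness fills in the whole disc, and `x`
  -- would be a relative interior point.
  have hout : ∀ v : T, ‖v‖ = ρ → e v ∉ Q := by
    intro v hv hev
    have hsphere : ∀ y ∈ (fun v : T => e v) '' Metric.sphere 0 ρ, y ∈ Q := by
      by_contra! hne
      obtain ⟨y, hyS, hyQ⟩ := hne
      have hmem_int : ∀ v : T, ‖v‖ = ρ → e v ∈ Q → e v ∈ interior (Q ∪ Mᶜ) := fun v hv hvQ => by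
        rw [← mem_relInterior_iff (hQM hvQ)]
        by_contra hni
        exact hnear v hv ⟨hvQ, hni⟩
      obtain ⟨_, ⟨v', hv', rfl⟩, hy1, hy2⟩ := hS (interior (Q ∪ Mᶜ)) Qᶜ isOpen_interior
        hQc.isOpen_compl (by
          rintro _ ⟨v', hv', rfl⟩
          by_cases hvQ : e v' ∈ Q
          · exact .inl (hmem_int v' (by simpa using hv') hvQ)
          · exact .inr hvQ) ⟨e v, ⟨v, by simpa using hv, rfl⟩, hmem_int v hv hev⟩ ⟨y, hyS, hyQ⟩
      have hv'' : ‖v'‖ = ρ := by simpa using hv'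
      exact (interior_subset hy1).elim hy2 fun h => h (he.apply_mem (hball v' hv''.le))
    refine hx.2 ⟨hx.1, ?_⟩
    obtain ⟨O', hO', himg⟩ := he.isOpenMap (Metric.ball 0 ρ) Metric.isOpen_ball
    have hxO : x ∈ O' ∩ M := by
      rw [← himg]
      exact ⟨0, ⟨by simpa using hρ, hball 0 (by simp)⟩, h0⟩
    refine mem_nhdsWithin.2 ⟨O', hO', hxO.1, ?_⟩
    rw [← himg]
    rintro _ ⟨a, ⟨haρ, ha⟩, rfl⟩
    have haρ' : ‖a‖ < ρ := by simpa using haρ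
    rcases eq_or_ne a 0 with rfl | ha0
    · exact h0 ▸ hx.1
    · have hna : 0 < ‖a‖ := norm_pos_iff.2 ha0
      have haT : a ∈ T := by rw [← SetLike.mem_coe, hT]; exact ha.1
      set b : T := (ρ / ‖a‖) • ⟨a, haT⟩ with hb
      have hbn : ‖b‖ = ρ := by
        rw [hb, norm_smul, Submodule.coe_norm, Real.norm_eq_abs, abs_of_pos (by positivity),
          div_mul_cancel₀ _ hna.ne']
      have hab : (‖a‖ / ρ) • (b : E3) = a := by
        rw [hb, Submodule.coe_smul, smul_smul, div_mul_div_cancel₀ hρ'.ne', div_self hna.ne',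
          one_smul]
      rw [← hab]
      exact hQ.apply_smul_mem he hx.1 (hball b hbn.le) (hsphere _ ⟨b, by simpa using hbn, rfl⟩)
        ⟨by positivity, (div_le_one hρ').2 haρ'.le⟩
  obtain ⟨O', hO', himg⟩ := he.isOpenMap (Metric.ball 0 ρ) Metric.isOpen_ball
  have hB : IsClosed ((fun v : T => e v) '' Metric.closedBall 0 ρ) :=
    ((isCompact_closedBall _ _).image_of_continuousOn hcontT).isClosed
  have hQO : ∀ y ∈ Q, y ∈ (fun v : T => e v) '' Metric.closedBall 0 ρ → y ∈ O' := by
    rintro _ hy ⟨v, hv, rfl⟩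
    have hv' : ‖v‖ ≤ ρ := by simpa using hv
    refine (himg ▸ mem_image_of_mem e ⟨?_, hball v hv'⟩ : e v ∈ O' ∩ M).1
    simpa using hv'.lt_of_ne fun h => hout v h hy
  have hOB : ∀ y ∈ O' ∩ M, ∃ v : T, ‖v‖ < ρ ∧ e v = y := by
    rw [← himg]
    rintro _ ⟨a, ⟨haρ, ha⟩, rfl⟩
    have haT : a ∈ T := by rw [← SetLike.mem_coe, hT]; exact ha.1
    exact ⟨⟨a, haT⟩, by simpa using haρ, rfl⟩
  -- Since `Q` misses the circle, it is covered by the open disc and the complement of the closed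
  -- disc. It is connected and contains the centre `x`, so it stays in the disc.
  have hzO : z ∈ O' := by
    by_contra hzO
    obtain ⟨y, hyQ, hy1, hy2⟩ := hQ.isPreconnected O' _ hO' hB.isOpen_compl
      (fun y hy => or_iff_not_imp_right.2 fun h => hQO y hy (not_not.1 h))
      ⟨x, hx.1, hQO x hx.1 ⟨0, by simp, h0⟩⟩ ⟨z, hz, fun h => hzO (hQO z hz h)⟩
    obtain ⟨v, hv, rfl⟩ := hOB y ⟨hy1, hQM hyQ⟩
    exact hy2 ⟨v, by simpa using hv.le, rfl⟩
  obtain ⟨v, hv, rfl⟩ := hOB z ⟨hzO, hQM hz⟩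
  refine (he.intrinsicDist_le (hball v hv.le)).trans_lt ?_
  rw [← ENNReal.ofReal_coe_nnreal, ENNReal.ofReal_lt_ofReal_iff hρ']
  exact hv

/-! ### The boundary of a quadrilateral -/

/-- Two points on a closed chain of four shortest arcs are at most half its length apart. -/
lemma two_mul_intrinsicDist_le_perimeter {M : Set E3} {V : Fin 4 → E3} {σ : Fin 4 → ℝ → E3}
    {len : Fin 4 → ℝ} (h : ∀ i, IsShortestArc M (σ i) (len i) (V i) (V (i + 1))) {x y : E3}
    (hx : x ∈ ⋃ i, σ i '' Icc 0 (len i)) (hy : y ∈ ⋃ i, σ i '' Icc 0 (len i)) :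
    2 * intrinsicDist M x y ≤ perimeter M V := by
  obtain ⟨i, s, hs, rfl⟩ := mem_iUnion.1 hx
  obtain ⟨j, t, ht, rfl⟩ := mem_iUnion.1 hy
  have hlen : ∀ i, 0 ≤ len i := fun i => (h i).length_nonneg
  have hper : perimeter M V = ENNReal.ofReal (∑ i, len i) := by
    rw [perimeter, ENNReal.ofReal_sum_of_nonneg fun i _ => hlen i]
    exact Finset.sum_congr rfl fun i _ => (h i).shortest
  have hto : ∀ i s, s ∈ Icc 0 (len i) → intrinsicDist M (σ i s) (V (i + 1)) ≤
      ENNReal.ofReal (len i - s) := fun i s hs => by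
    have := (h i).intrinsicDist_le hs.2
    rwa [(h i).target] at this
  have hfrom : ∀ i s, s ∈ Icc 0 (len i) → intrinsicDist M (V i) (σ i s) ≤
      ENNReal.ofReal s := fun i s hs => by
    have := (h i).intrinsicDist_le hs.1
    rwa [(h i).source, sub_zero] at this
  have hadd : ∀ x y z a b, 0 ≤ a → 0 ≤ b → intrinsicDist M x y ≤ ENNReal.ofReal a →
      intrinsicDist M y z ≤ ENNReal.ofReal b → intrinsicDist M x z ≤ ENNReal.ofReal (a + b) :=
    fun x y z a b ha hb h1 h2 => by
      rw [ENNReal.ofReal_add ha hb]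
      exact (intrinsicDist_triangle M x y z).trans (add_le_add h1 h2)
  have hside : ∀ i, intrinsicDist M (V i) (V (i + 1)) ≤ ENNReal.ofReal (len i) :=
    fun i => (h i).shortest.le
  have hsum : ∀ i, ∑ i, len i = len i + len (i + 1) + len (i + 1 + 1) + len (i + 1 + 1 + 1) := by
    intro i
    rw [Fin.sum_univ_four]
    fin_cases i <;> simp <;> ring
  have hcyc : ∀ i : Fin 4, i + 1 + 1 + 1 + 1 = i := by decide
  -- Two complementary routes round the chain together have the length of the perimeter, and each
  -- bounds the same distance.
  have hfinish : ∀ x y a b, 0 ≤ a → 0 ≤ b → a + b = ∑ i, len i →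
      intrinsicDist M x y ≤ ENNReal.ofReal a → intrinsicDist M y x ≤ ENNReal.ofReal b →
      2 * intrinsicDist M x y ≤ perimeter M V := fun x y a b ha hb hab h1 h2 => by
    rw [hper, ← hab, ENNReal.ofReal_add ha hb, two_mul]
    exact add_le_add h1 (intrinsicDist_comm M x y ▸ h2)
  -- going forward from a point of one arc to a point of another, by the number of arcs between
  have fwd1 : ∀ i s t, s ∈ Icc 0 (len i) → t ∈ Icc 0 (len (i + 1)) →
      intrinsicDist M (σ i s) (σ (i + 1) t) ≤ ENNReal.ofReal (len i - s + t) :=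
    fun i s t hs ht => hadd _ _ _ _ _ (sub_nonneg.2 hs.2) ht.1 (hto i s hs) (hfrom _ t ht)
  have fwd2 : ∀ i s t, s ∈ Icc 0 (len i) → t ∈ Icc 0 (len (i + 1 + 1)) →
      intrinsicDist M (σ i s) (σ (i + 1 + 1) t) ≤
        ENNReal.ofReal (len i - s + (len (i + 1) + t)) :=
    fun i s t hs ht => hadd _ _ _ _ _ (sub_nonneg.2 hs.2) (add_nonneg (hlen _) ht.1) (hto i s hs)
      (hadd _ _ _ _ _ (hlen _) ht.1 (hside _) (hfrom _ t ht))
  have fwd3 : ∀ i s t, s ∈ Icc 0 (len i) → t ∈ Icc 0 (len (i + 1 + 1 + 1)) →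
      intrinsicDist M (σ i s) (σ (i + 1 + 1 + 1) t) ≤
        ENNReal.ofReal (len i - s + (len (i + 1) + (len (i + 1 + 1) + t))) :=
    fun i s t hs ht => hadd _ _ _ _ _ (sub_nonneg.2 hs.2)
      (add_nonneg (hlen _) (add_nonneg (hlen _) ht.1)) (hto i s hs)
      (hadd _ _ _ _ _ (hlen _) (add_nonneg (hlen _) ht.1) (hside _)
        (hadd _ _ _ _ _ (hlen _) ht.1 (hside _) (hfrom _ t ht)))
  have same : ∀ i s t, s ∈ Icc 0 (len i) → t ∈ Icc 0 (len i) → s ≤ t →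
      2 * intrinsicDist M (σ i s) (σ i t) ≤ perimeter M V := by
    intro i s t hs ht hst
    refine hfinish _ _ (t - s) (len i - t + (len (i + 1) + (len (i + 1 + 1) +
      (len (i + 1 + 1 + 1) + s)))) (by linarith) ?_ ?_ ((h i).intrinsicDist_le hst) ?_
    · linarith [ht.2, hs.1, hlen (i + 1), hlen (i + 1 + 1), hlen (i + 1 + 1 + 1)]
    · rw [hsum i]; ring
    · have hs1 := hs.1
      have h1 := hlen (i + 1)
      have h2 := hlen (i + 1 + 1)
      have h3 := hlen (i + 1 + 1 + 1)
      have h4 := hside (i + 1 + 1 + 1)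
      rw [hcyc] at h4
      exact hadd _ _ _ _ _ (sub_nonneg.2 ht.2) (by positivity) (hto i t ht)
        (hadd _ _ _ _ _ h1 (by positivity) (hside _)
          (hadd _ _ _ _ _ h2 (by positivity) (hside _)
            (hadd _ _ _ _ _ h3 hs.1 h4 (hfrom i s hs))))
  have adjacent : ∀ i s t, s ∈ Icc 0 (len i) → t ∈ Icc 0 (len (i + 1)) →
      2 * intrinsicDist M (σ i s) (σ (i + 1) t) ≤ perimeter M V := by
    intro i s t hs ht
    have hs' : s ∈ Icc 0 (len (i + 1 + 1 + 1 + 1)) := by rwa [hcyc]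
    have h1 := fwd3 (i + 1) t s ht hs'
    rw [hcyc] at h1
    refine hfinish _ _ _ _ ?_ ?_ ?_ (fwd1 i s t hs ht) h1
    · linarith [hs.2, ht.1]
    · linarith [ht.2, hs.1, hlen (i + 1 + 1), hlen (i + 1 + 1 + 1)]
    · rw [hsum i]; ring
  -- The case of three steps forward is stated as one step back, so that it reduces to `adjacent` by
  -- symmetry.
  have hcases : ∀ i j : Fin 4, j = i ∨ j = i + 1 ∨ j = i + 1 + 1 ∨ i = j + 1 := by decide
  rcases hcases i j with rfl | rfl | rfl | rfl
  · rcases le_total s t with hst | hst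
    · exact same _ s t hs ht hst
    · rw [intrinsicDist_comm]
      exact same _ t s ht hs hst
  · exact adjacent i s t hs ht
  · have hs' : s ∈ Icc 0 (len (i + 1 + 1 + 1 + 1)) := by rwa [hcyc]
    have h1 := fwd2 (i + 1 + 1) t s ht hs'
    rw [hcyc] at h1
    refine hfinish _ _ _ _ ?_ ?_ ?_ (fwd2 i s t hs ht) h1
    · linarith [hs.2, ht.1, hlen (i + 1)]
    · linarith [ht.2, hs.1, hlen (i + 1 + 1 + 1)]
    · rw [hsum i]; ring
  · rw [intrinsicDist_comm]
    exact adjacent j t s ht hs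

/-! ### The first variation at a Fermat-Torricelli point -/

/-- Moving from `P` with velocity `v` for a short time `h` and then rejoining `γ i` at `γ i h`
bounds the new distance to `V i` by about `l i - h + h * ‖v - deriv (γ i) 0‖`. Comparing with the
minimum and dividing by `h` gives the claim. Only this upper bound is needed, not differentiability
of the distance. -/
lemma IsFermatTorricelliPoint.sum_le {M : Set E3} (hM : IsConvexC2Surface M) {V : Fin 4 → E3}
    {w : Fin 4 → ℝ} (hw : ∀ i, 0 < w i) {P : E3} (hmin : IsFermatTorricelliPoint M V w P)
    {γ : Fin 4 → ℝ → E3} {l : Fin 4 → ℝ} (hγ : ∀ i, IsShortestArc M (γ i) (l i) P (V i))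
    (hl : ∀ i, 0 < l i) {v : E3} (hv : v ∈ tangentPlane M P) :
    ∑ i, w i ≤ ∑ i, w i * ‖v - deriv (γ i) 0‖ := by
  obtain ⟨c, hc0, hcM, hc⟩ := hv
  have key : ∀ ε > 0, ∑ i, w i ≤ ∑ i, w i * ((1 + ε) * (‖v - deriv (γ i) 0‖ + ε)) := by
    intro ε hε
    obtain ⟨δ, hδ, hdist⟩ := exists_intrinsicDist_le hM hmin.1 hε
    have hγd : ∀ i, HasDerivAt (γ i) (deriv (γ i) 0) 0 := fun i => (hγ i).geodesic.hasDerivAt 0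
    have h1 : ∀ᶠ h in 𝓝[>] (0 : ℝ), c h ∈ M ∧ dist (c h) P < δ :=
      (hcM.and (hc.continuousAt.eventually
        (by rw [hc0]; exact Metric.ball_mem_nhds P hδ))).filter_mono nhdsWithin_le_nhds
    have h2 : ∀ᶠ h in 𝓝[>] (0 : ℝ), ∀ i, dist (γ i h) P < δ ∧ h < l i :=
      (eventually_all.2 fun i => ((hγd i).continuousAt.eventually
        (by rw [(hγ i).source]; exact Metric.ball_mem_nhds P hδ)).and
          (gt_mem_nhds (hl i))).filter_mono nhdsWithin_le_nhds
    have h3 : ∀ᶠ h in 𝓝[>] (0 : ℝ), ∀ i, ‖c h - γ i h‖ ≤ h * (‖v - deriv (γ i) 0‖ + ε) := by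
      refine eventually_all.2 fun i => ?_
      have := (hasDerivAt_iff_tendsto_slope_zero.1 (hc.sub (hγd i))).norm.eventually
        (gt_mem_nhds (lt_add_of_pos_right _ hε))
      filter_upwards [this.filter_mono (nhdsWithin_mono 0 fun x (hx : 0 < x) => hx.ne'),
        self_mem_nhdsWithin] with h hh hpos
      have hpos' : 0 < h := hpos
      simp only [zero_add, Pi.sub_apply, hc0, (hγ i).source, sub_self, sub_zero, norm_smul,
        norm_inv, Real.norm_eq_abs, abs_of_pos hpos'] at hh
      rw [inv_mul_lt_iff₀ hpos'] at hh
      exact hh.le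
    obtain ⟨h, ⟨hcM, hcP⟩, hγP, hch, hpos⟩ :=
      (h1.and (h2.and (h3.and self_mem_nhdsWithin))).exists
    have hpos' : 0 < h := hpos
    have hbound : ∀ i, intrinsicDist M (c h) (V i) ≤
        ENNReal.ofReal ((1 + ε) * (h * (‖v - deriv (γ i) 0‖ + ε)) + (l i - h)) := fun i => by
      have hle := sub_nonneg.2 (hγP i).2.le
      rw [ENNReal.ofReal_add (by positivity) hle]
      refine (intrinsicDist_triangle M _ (γ i h) _).trans (add_le_add ?_ ?_)
      · refine (hdist _ hcM _ ((hγ i).geodesic.mem h) hcP (hγP i).1).trans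
          (ENNReal.ofReal_le_ofReal ?_)
        gcongr
        exact hch i
      · have := (hγ i).intrinsicDist_le (hγP i).2.le
        rwa [(hγ i).target] at this
    have hcomp := (hmin.2 _ hcM).trans (Finset.sum_le_sum fun i _ =>
      mul_le_mul_right (hbound i) (ENNReal.ofReal (w i)))
    have hnn : ∀ i, 0 ≤ (1 + ε) * (h * (‖v - deriv (γ i) 0‖ + ε)) + (l i - h) := fun i => by
      have hle := sub_nonneg.2 (hγP i).2.le
      positivity
    simp only [(hγ _).shortest, ← ENNReal.ofReal_mul (hw _).le] at hcomp
    rw [← ENNReal.ofReal_sum_of_nonneg fun i _ => mul_nonneg (hw i).le (hl i).le,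
      ← ENNReal.ofReal_sum_of_nonneg fun i _ => mul_nonneg (hw i).le (hnn i),
      ENNReal.ofReal_le_ofReal_iff (Finset.sum_nonneg fun i _ => mul_nonneg (hw i).le (hnn i))]
      at hcomp
    refine le_of_mul_le_mul_left ?_ hpos'
    have hid : ∑ i, w i * ((1 + ε) * (h * (‖v - deriv (γ i) 0‖ + ε)) + (l i - h)) =
        h * ∑ i, w i * ((1 + ε) * (‖v - deriv (γ i) 0‖ + ε)) + ∑ i, w i * l i - h * ∑ i, w i := by
      rw [Finset.mul_sum, Finset.mul_sum, ← Finset.sum_add_distrib, ← Finset.sum_sub_distrib]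
      exact Finset.sum_congr rfl fun i _ => by ring
    linarith
  have hcont : Continuous fun ε : ℝ => ∑ i, w i * ((1 + ε) * (‖v - deriv (γ i) 0‖ + ε)) := by
    fun_prop
  have hlim := (hcont.tendsto 0).mono_left (nhdsWithin_le_nhds (s := Ioi 0))
  simp only [add_zero, one_mul] at hlim
  exact ge_of_tendsto hlim (by filter_upwards [self_mem_nhdsWithin] with ε hε using key ε hε)

/-- At a Fermat-Torricelli point the weighted unit vectors toward the vertices balance. -/
lemma IsFermatTorricelliPoint.sum_smul_deriv_eq_zero {M : Set E3} (hM : IsConvexC2Surface M)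
    {V : Fin 4 → E3} {w : Fin 4 → ℝ} (hw : ∀ i, 0 < w i) {P : E3}
    (hmin : IsFermatTorricelliPoint M V w P)
    {γ : Fin 4 → ℝ → E3} {l : Fin 4 → ℝ} (hγ : ∀ i, IsShortestArc M (γ i) (l i) P (V i))
    (hl : ∀ i, 0 < l i) : ∑ i, w i • deriv (γ i) 0 = 0 := by
  obtain ⟨T, -, hT⟩ := exists_submodule_eq_tangentPlane hM hmin.1
  set S := ∑ i, w i • deriv (γ i) 0 with hS
  have hST : S ∈ T := T.sum_mem fun i _ => T.smul_mem _ (by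
    rw [← SetLike.mem_coe, hT, ← (hγ i).source]; exact (hγ i).geodesic.deriv_mem 0)
  have hW : 0 < ∑ i, w i := Finset.sum_pos (fun i _ => hw i) Finset.univ_nonempty
  -- Testing with `v = t • S` gives a first-order gain `t * ‖S‖ ^ 2` against a second-order loss `(∑
  -- i, w i) * t ^ 2 * ‖S‖ ^ 2 / 2`; this `t` makes the loss half the gain, which forces `S = 0`.
  set t := (∑ i, w i)⁻¹ with ht
  have htp : 0 < t := by positivity
  have h1 := hmin.sum_le hM hw hγ hl (v := t • S) (hT ▸ T.smul_mem t hST)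
  -- From `2 * x ≤ x ^ 2 + 1`, which removes the square root in the norm.
  have h2 : ∀ i, ‖t • S - deriv (γ i) 0‖ ≤
      1 - t * inner ℝ (deriv (γ i) 0) S + t ^ 2 * ‖S‖ ^ 2 / 2 := fun i => by
    have h3 : ‖t • S - deriv (γ i) 0‖ ^ 2 =
        t ^ 2 * ‖S‖ ^ 2 - 2 * (t * inner ℝ (deriv (γ i) 0) S) + 1 := by
      rw [norm_sub_sq_real, norm_smul, inner_smul_left, (hγ i).unitSpeed, mul_pow,
        Real.norm_eq_abs, sq_abs, real_inner_comm]
      simp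
    nlinarith [sq_nonneg (‖t • S - deriv (γ i) 0‖ - 1)]
  have h4 : ∑ i, w i * inner ℝ (deriv (γ i) 0) S = ‖S‖ ^ 2 := by
    rw [← real_inner_self_eq_norm_sq]
    conv_rhs => rw [hS, sum_inner]
    exact Finset.sum_congr rfl fun i _ => by rw [inner_smul_left]; simp [hS]
  have h5 : ∑ i, w i * ‖t • S - deriv (γ i) 0‖ ≤
      ∑ i, w i - t * ‖S‖ ^ 2 + (∑ i, w i) * (t ^ 2 * ‖S‖ ^ 2 / 2) := by
    refine (Finset.sum_le_sum fun i _ => mul_le_mul_of_nonneg_left (h2 i) (hw i).le).trans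
      (le_of_eq ?_)
    rw [← h4]
    generalize t ^ 2 * _ / 2 = k
    simp only [Fin.sum_univ_four]
    ring
  have h6 : (∑ i, w i) * (t ^ 2 * ‖S‖ ^ 2 / 2) = t * ‖S‖ ^ 2 / 2 := by
    rw [ht]; field_simp
  have h7 : ‖S‖ ^ 2 = 0 := by
    have : t * ‖S‖ ^ 2 ≤ 0 := by linarith
    nlinarith [sq_nonneg ‖S‖]
  simpa using h7

/-! ### Four points on a circle -/

/-- Twice the signed area of the triangle `a b c`. -/
def signedArea (a b c : E2) : ℝ :=
  (b 0 - a 0) * (c 1 - a 1) - (b 1 - a 1) * (c 0 - a 0)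

/-- A line meets a circle at most twice: if `c = a + k • (b - a)`, the three norm conditions leave
`k * (k - 1) * ‖b - a‖ ^ 2 = 0`, so `c` is `a` or `b`. -/
lemma signedArea_ne_zero {a b c : E2} (ha : ‖a‖ = 1) (hb : ‖b‖ = 1) (hc : ‖c‖ = 1) (hab : a ≠ b)
    (hca : c ≠ a) (hcb : c ≠ b) : signedArea a b c ≠ 0 := by
  intro h
  have hsq : ∀ x : E2, ‖x‖ = 1 → x 0 ^ 2 + x 1 ^ 2 = 1 := fun x hx => by
    have := EuclideanSpace.real_norm_sq_eq x
    rw [hx, Fin.sum_univ_two] at this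
    linarith
  have hext : ∀ x y : E2, x 0 = y 0 → x 1 = y 1 → x = y := fun x y h0 h1 => by
    ext i; fin_cases i <;> assumption
  have ha' := hsq a ha
  have hb' := hsq b hb
  have hc' := hsq c hc
  unfold signedArea at h
  obtain ⟨p, hp⟩ : ∃ p, p = b 0 - a 0 := ⟨_, rfl⟩
  obtain ⟨q, hq⟩ : ∃ q, q = b 1 - a 1 := ⟨_, rfl⟩
  rw [← hp, ← hq] at h
  have hb0 : b 0 = a 0 + p := by linarith
  have hb1 : b 1 = a 1 + q := by linarith
  rw [hb0, hb1] at hb'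
  have hN : 0 < p ^ 2 + q ^ 2 := by
    by_contra hN
    have hp0 : p = 0 := by nlinarith [sq_nonneg p, sq_nonneg q]
    have hq0 : q = 0 := by nlinarith [sq_nonneg p, sq_nonneg q]
    exact hab (hext _ _ (by rw [hb0, hp0, add_zero]) (by rw [hb1, hq0, add_zero]))
  obtain ⟨k, hk⟩ : ∃ k, k = (p * (c 0 - a 0) + q * (c 1 - a 1)) / (p ^ 2 + q ^ 2) := ⟨_, rfl⟩
  rw [eq_div_iff hN.ne'] at hk
  have hc0 : c 0 = a 0 + k * p := by
    refine mul_right_cancel₀ hN.ne' ?_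
    linear_combination (-q) * h - p * hk
  have hc1 : c 1 = a 1 + k * q := by
    refine mul_right_cancel₀ hN.ne' ?_
    linear_combination p * h - q * hk
  rw [hc0, hc1] at hc'
  have hkk : k * (k - 1) * (p ^ 2 + q ^ 2) = 0 := by
    linear_combination hc' - (1 - k) * ha' - k * hb'
  rcases mul_eq_zero.1 ((mul_eq_zero.1 hkk).resolve_right hN.ne') with h0 | h0
  · exact hca (hext _ _ (by simp [hc0, h0]) (by simp [hc1, h0]))
  · have h1 : k = 1 := by linarith
    exact hcb (hext _ _ (by simp [hc0, hb0, h1]) (by simp [hc1, hb1, h1]))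

/-- A path on the unit circle that avoids `a` and `b` stays on one side of the chord `a b`. -/
lemma signedArea_mul_pos_of_path {a b : E2} (ha : ‖a‖ = 1) (hb : ‖b‖ = 1) (hab : a ≠ b)
    {θ : ℝ → E2} {L : ℝ} (hL : 0 ≤ L) (hθ : ContinuousOn θ (Icc 0 L))
    (hn : ∀ s ∈ Icc 0 L, ‖θ s‖ = 1) (hθa : ∀ s ∈ Icc 0 L, θ s ≠ a)
    (hθb : ∀ s ∈ Icc 0 L, θ s ≠ b) :
    0 < signedArea a b (θ 0) * signedArea a b (θ L) := by
  have hne : ∀ s ∈ Icc 0 L, signedArea a b (θ s) ≠ 0 := fun s hs =>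
    signedArea_ne_zero ha hb (hn s hs) hab (hθa s hs) (hθb s hs)
  have hcont : ContinuousOn (fun s => signedArea a b (θ s)) (Icc 0 L) := by
    have h : Continuous fun x : E2 => signedArea a b x := by
      unfold signedArea; fun_prop
    exact h.comp_continuousOn hθ
  have h0 := hne 0 ⟨le_rfl, hL⟩
  have h1 := hne L ⟨hL, le_rfl⟩
  by_contra hneg
  rw [not_lt] at hneg
  have hmem : (0 : ℝ) ∈ uIcc (signedArea a b (θ 0)) (signedArea a b (θ L)) := by
    rw [mem_uIcc]
    rcases lt_or_gt_of_ne h0 with h | h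
    · left; exact ⟨h.le, by nlinarith⟩
    · right; exact ⟨by nlinarith, h.le⟩
  obtain ⟨s, hs, hs0⟩ := intermediate_value_uIcc
    (f := fun s => signedArea a b (θ s)) (by rwa [uIcc_of_le hL]) hmem
  rw [uIcc_of_le hL] at hs
  exact hne s hs hs0

/-- Balanced weighted vertices of a convex quadrilateral do not lie, with alternating signs, on
a line. -/
lemma eq_zero_of_signedArea {z : Fin 4 → E2} {w : Fin 4 → ℝ} (hw : ∀ i, 0 < w i)
    (hsum : ∑ i, w i • z i = 0)
    (h0 : 0 < signedArea (z 2) (z 3) (z 0) * signedArea (z 2) (z 3) (z 1))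
    (h1 : 0 < signedArea (z 3) (z 0) (z 1) * signedArea (z 3) (z 0) (z 2))
    (h2 : 0 < signedArea (z 0) (z 1) (z 2) * signedArea (z 0) (z 1) (z 3)) {p q : ℝ}
    (ha : p * (w 0 * z 0 0 + w 1 * z 1 0) + q * (w 0 * z 0 1 + w 1 * z 1 1) = 0)
    (hb : p * (w 0 * z 0 0 + w 3 * z 3 0) + q * (w 0 * z 0 1 + w 3 * z 3 1) = 0) :
    p = 0 ∧ q = 0 := by
  obtain ⟨D0, hD0⟩ : ∃ D, D = signedArea (z 2) (z 3) (z 1) := ⟨_, rfl⟩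
  obtain ⟨D1, hD1⟩ : ∃ D, D = signedArea (z 2) (z 3) (z 0) := ⟨_, rfl⟩
  obtain ⟨D2, hD2⟩ : ∃ D, D = signedArea (z 3) (z 0) (z 1) := ⟨_, rfl⟩
  obtain ⟨D3, hD3⟩ : ∃ D, D = signedArea (z 0) (z 1) (z 2) := ⟨_, rfl⟩
  have hD1' : signedArea (z 3) (z 0) (z 2) = D1 := by rw [hD1]; unfold signedArea; ring
  have hD2' : signedArea (z 0) (z 1) (z 3) = D2 := by rw [hD2]; unfold signedArea; ring
  rw [hD1', ← hD2] at h1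
  rw [hD2', ← hD3] at h2
  rw [← hD1, ← hD0] at h0
  have hs0 : w 0 * z 0 0 + w 1 * z 1 0 + w 2 * z 2 0 + w 3 * z 3 0 = 0 := by
    simpa [Fin.sum_univ_four] using congrArg (fun x : E2 => x 0) hsum
  have hs1 : w 0 * z 0 1 + w 1 * z 1 1 + w 2 * z 2 1 + w 3 * z 3 1 = 0 := by
    simpa [Fin.sum_univ_four] using congrArg (fun x : E2 => x 1) hsum
  obtain ⟨f, hf⟩ : ∃ f : Fin 4 → ℝ, ∀ i, f i = p * z i 0 + q * z i 1 := ⟨_, fun _ => rfl⟩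
  have hf1 : w 1 * f 1 = -(w 0 * f 0) := by rw [hf, hf]; linear_combination ha
  have hf3 : w 3 * f 3 = -(w 0 * f 0) := by rw [hf, hf]; linear_combination hb
  have hf2 : w 2 * f 2 = w 0 * f 0 := by
    rw [hf, hf]; linear_combination p * hs0 + q * hs1 - ha - hb
  -- The linear dependence of four points in the plane, each weighted by the area of the triangle of
  -- the other three. As all `D`'s have one sign, it expresses the crossing of the diagonals.
  have hdiag : D0 * f 0 + D2 * f 2 = D1 * f 1 + D3 * f 3 := by
    rw [hD0, hD1, hD2, hD3, hf, hf, hf, hf]; unfold signedArea; ring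
  have hw0 := hw 0
  have hw1 := hw 1
  have hw2 := hw 2
  have hw3 := hw 3
  have hprod : w 0 * f 0 * (D0 * (w 1 * w 2 * w 3) + D2 * (w 0 * w 1 * w 3) +
      D1 * (w 0 * w 2 * w 3) + D3 * (w 0 * w 1 * w 2)) = 0 := by
    linear_combination w 0 * w 1 * w 2 * w 3 * hdiag - D2 * w 0 * w 1 * w 3 * hf2 +
      D1 * w 0 * w 2 * w 3 * hf1 + D3 * w 0 * w 1 * w 2 * hf3
  have hf0 : f 0 = 0 := by
    have hne : D0 * (w 1 * w 2 * w 3) + D2 * (w 0 * w 1 * w 3) +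
      D1 * (w 0 * w 2 * w 3) + D3 * (w 0 * w 1 * w 2) ≠ 0 := by
      rcases pos_and_pos_or_neg_and_neg_of_mul_pos h0 with ⟨hp1, hp0⟩ | ⟨hp1, hp0⟩
      · have hp2 : 0 < D2 := pos_of_mul_pos_left h1 hp1.le
        have hp3 : 0 < D3 := pos_of_mul_pos_left h2 hp2.le
        positivity
      · have hp2 : D2 < 0 := neg_of_mul_pos_left h1 hp1.le
        have hp3 : D3 < 0 := neg_of_mul_pos_left h2 hp2.le
        have e0 := mul_neg_of_neg_of_pos hp0 (by positivity : 0 < w 1 * w 2 * w 3)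
        have e1 := mul_neg_of_neg_of_pos hp1 (by positivity : 0 < w 0 * w 2 * w 3)
        have e2 := mul_neg_of_neg_of_pos hp2 (by positivity : 0 < w 0 * w 1 * w 3)
        have e3 := mul_neg_of_neg_of_pos hp3 (by positivity : 0 < w 0 * w 1 * w 2)
        linarith
    exact (mul_eq_zero.1 ((mul_eq_zero.1 hprod).resolve_right hne)).resolve_left hw0.ne'
  rw [hf0, mul_zero, neg_zero] at hf1
  have g1 := (mul_eq_zero.1 hf1).resolve_left hw1.ne'
  rw [hf0, mul_zero] at hf2
  have g2 := (mul_eq_zero.1 hf2).resolve_left hw2.ne'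
  have hD3ne : D3 ≠ 0 := fun h => by rw [h, zero_mul] at h2; exact h2.ne' rfl
  rw [hf] at hf0 g1 g2
  have e1 : p * D3 = 0 := by
    rw [hD3]; unfold signedArea
    linear_combination (z 2 1 - z 0 1) * (g1 - hf0) - (z 1 1 - z 0 1) * (g2 - hf0)
  have e2 : q * D3 = 0 := by
    rw [hD3]; unfold signedArea
    linear_combination (z 1 0 - z 0 0) * (g2 - hf0) - (z 2 0 - z 0 0) * (g1 - hf0)
  exact ⟨(mul_eq_zero.1 e1).resolve_right hD3ne, (mul_eq_zero.1 e2).resolve_right hD3ne⟩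

/-- Euclidean coordinates in a plane through the origin. -/
lemma exists_plane_coordinates {T : Submodule ℝ E3} (hT : Module.finrank ℝ T = 2) :
    ∃ Φ : E3 →L[ℝ] E2, ∀ v ∈ T, ‖Φ v‖ = ‖v‖ := by
  let b := (stdOrthonormalBasis ℝ T).reindex (finCongr hT)
  refine ⟨(b.repr.toContinuousLinearEquiv : T →L[ℝ] E2).comp T.orthogonalProjectionOnto,
    fun v hv => ?_⟩
  have : T.orthogonalProjectionOnto v = ⟨v, hv⟩ :=
    Submodule.orthogonalProjectionOnto_mem_subspace_eq_self (⟨v, hv⟩ : T)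
  simp [this]

/-- The balance gives equality of opposite sides. If the vertices lay on a line with direction `v`,
the functional orthogonal to `Φ v` would kill both sides at the first vertex, so
`eq_zero_of_signedArea` gives `Φ v = 0`. Then every functional kills them, including the non-zero
one with coefficients `1, 0`. -/
lemma isParallelogram_of_signedArea {Φ : E3 →L[ℝ] E2}
    {u : Fin 4 → E3} {w : Fin 4 → ℝ} (hw : ∀ i, 0 < w i)
    (hsum : ∑ i, w i • u i = 0)
    (h0 : 0 < signedArea (Φ (u 2)) (Φ (u 3)) (Φ (u 0)) * signedArea (Φ (u 2)) (Φ (u 3)) (Φ (u 1)))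
    (h1 : 0 < signedArea (Φ (u 3)) (Φ (u 0)) (Φ (u 1)) * signedArea (Φ (u 3)) (Φ (u 0)) (Φ (u 2)))
    (h2 : 0 < signedArea (Φ (u 0)) (Φ (u 1)) (Φ (u 2)) * signedArea (Φ (u 0)) (Φ (u 1)) (Φ (u 3))) :
    IsParallelogram (-(w 0 • u 0)) (w 1 • u 1) (-(w 2 • u 2)) (w 3 • u 3) := by
  have hsum' := hsum
  rw [Fin.sum_univ_four] at hsum'
  refine ⟨by rw [← sub_eq_zero, ← hsum']; abel, ?_⟩
  rw [affineIndependent_iff_not_collinear_set, collinear_iff_of_mem (p₀ := -(w 0 • u 0)) (by simp)]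
  rintro ⟨v, hv⟩
  obtain ⟨r, hr⟩ := hv (w 1 • u 1) (by simp)
  obtain ⟨s, hs⟩ := hv (w 3 • u 3) (by simp)
  have hr' : w 0 • Φ (u 0) + w 1 • Φ (u 1) = r • Φ v := by
    simpa [add_comm] using congrArg (fun x => w 0 • Φ (u 0) + Φ x) hr
  have hs' : w 0 • Φ (u 0) + w 3 • Φ (u 3) = s • Φ v := by
    simpa [add_comm] using congrArg (fun x => w 0 • Φ (u 0) + Φ x) hs
  have hr0 : w 0 * Φ (u 0) 0 + w 1 * Φ (u 1) 0 = r * Φ v 0 := by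
    simpa using congrArg (fun x : E2 => x 0) hr'
  have hr1 : w 0 * Φ (u 0) 1 + w 1 * Φ (u 1) 1 = r * Φ v 1 := by
    simpa using congrArg (fun x : E2 => x 1) hr'
  have hs0 : w 0 * Φ (u 0) 0 + w 3 * Φ (u 3) 0 = s * Φ v 0 := by
    simpa using congrArg (fun x : E2 => x 0) hs'
  have hs1 : w 0 * Φ (u 0) 1 + w 3 * Φ (u 3) 1 = s * Φ v 1 := by
    simpa using congrArg (fun x : E2 => x 1) hs'
  have hz : ∑ i, w i • Φ (u i) = 0 := by simpa using congrArg Φ hsum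
  have key := @eq_zero_of_signedArea (fun i => Φ (u i)) w hw hz h0 h1 h2
  simp only [hr0, hr1, hs0, hs1] at key
  obtain ⟨k1, k0⟩ := @key (-(Φ v 1)) (Φ v 0) (by ring) (by ring)
  exact one_ne_zero (@key 1 0 (by rw [k0]; ring) (by rw [k0]; ring)).1

/-! ### The quadrilateral seen from an interior point -/

/-- Openness of `e` onto its image in `M` is continuity of its inverse. -/
lemma IsExpHomeo.continuousOn_invFunOn {M : Set E3} {p : E3} {r : ℝ≥0} {e : E3 → E3}
    (h : IsExpHomeo M p r e) :
    ContinuousOn (Function.invFunOn e (tangentBall M p r)) (e '' tangentBall M p r) := by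
  refine continuousOn_iff'.2 fun W hW => ?_
  obtain ⟨O', hO', himg⟩ := h.isOpenMap W hW
  refine ⟨O', hO', ?_⟩
  ext y
  constructor
  · rintro ⟨hyW, v, hv, rfl⟩
    rw [mem_preimage, h.injOn.leftInvOn_invFunOn hv] at hyW
    exact ⟨(himg ▸ mem_image_of_mem e ⟨hyW, hv⟩ : e v ∈ O' ∩ M).1, mem_image_of_mem e hv⟩
  · rintro ⟨hyO, hyv⟩
    refine ⟨?_, hyv⟩
    obtain ⟨v, hv, rfl⟩ := hyv
    obtain ⟨v', ⟨hv'W, hv'⟩, hvv'⟩ : e v ∈ e '' (W ∩ tangentBall M p r) :=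
      himg ▸ ⟨hyO, h.apply_mem hv⟩
    rw [mem_preimage, h.injOn.leftInvOn_invFunOn hv, ← h.injOn hv' hv hvv']
    exact hv'W

/-- Shortest arcs from a relative interior point to different points of the relative boundary have
different directions. -/
lemma IsGeodesicallyConvex.eq_of_deriv_eq {M Q : Set E3} (hQ : IsGeodesicallyConvex M Q)
    {r : ℝ≥0} (hr : ∀ x ∈ Q, ∃ e, IsExpHomeo M x r e) {p q₁ q₂ : E3} (hp : p ∈ relInterior M Q)
    (hq₁ : q₁ ∈ Q \ relInterior M Q) (hq₂ : q₂ ∈ Q \ relInterior M Q) {γ₁ γ₂ : ℝ → E3} {l₁ l₂ : ℝ}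
    (h₁ : IsShortestArc M γ₁ l₁ p q₁) (h₂ : IsShortestArc M γ₂ l₂ p q₂) (hl₁ : l₁ < r)
    (hl₂ : l₂ < r) (hd : deriv γ₁ 0 = deriv γ₂ 0) : q₁ = q₂ := by
  wlog hle : l₁ ≤ l₂ generalizing q₁ q₂ γ₁ γ₂ l₁ l₂
  · exact (this hq₂ hq₁ h₂ h₁ hl₂ hl₁ hd.symm (le_of_not_ge hle)).symm
  obtain ⟨e, he⟩ := hr p hp.1
  have heq : q₁ = γ₂ l₁ := by
    rw [← (he.apply_arc h₂ h₁.length_nonneg hl₁).2, ← hd, (he.apply_arc h₁ h₁.length_nonneg hl₁).2,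
      h₁.target]
  rcases hle.eq_or_lt with rfl | hlt
  · rw [heq, h₂.target]
  -- Otherwise `q₁` lies on the longer arc strictly before its end, where that arc is still in the
  -- relative interior.
  · obtain ⟨e', he'⟩ := hr q₂ hq₂.1
    exact absurd (heq ▸ hQ.arc_mem_relInterior he' hp hq₂.1 h₂ hl₂ ⟨h₁.length_nonneg, hlt⟩) hq₁.2

/-- The initial direction of a shortest arc from an interior point `P` to `y` is a continuous
function of `y` on the relative boundary of `Q`, and separates its points. -/
lemma IsGeodesicallyConvex.exists_direction {M Q : Set E3} (hQ : IsGeodesicallyConvex M Q)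
    {r : ℝ≥0} (hr : ∀ x ∈ Q, ∃ e, IsExpHomeo M x r e) {P : E3} (hP : P ∈ relInterior M Q)
    (hd : ∀ y ∈ Q \ relInterior M Q, intrinsicDist M P y < r) :
    ∃ θ : E3 → E3, ContinuousOn θ (Q \ relInterior M Q) ∧ InjOn θ (Q \ relInterior M Q) ∧
      (∀ y ∈ Q \ relInterior M Q, θ y ∈ tangentPlane M P ∧ ‖θ y‖ = 1) ∧
      ∀ y ∈ Q \ relInterior M Q, ∀ γ l, IsShortestArc M γ l P y → deriv γ 0 = θ y := by
  obtain ⟨e, he⟩ := hr P hP.1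
  set g := Function.invFunOn e (tangentBall M P r) with hg
  have hlr : ∀ y ∈ Q \ relInterior M Q, ∀ γ l, IsShortestArc M γ l P y → 0 < l ∧ l < r := by
    intro y hy γ l hγ
    constructor
    · refine hγ.length_nonneg.lt_of_ne fun h => hy.2 ?_
      rw [← hγ.target, ← h, hγ.source]
      exact hP
    · have := hd y hy
      rw [hγ.shortest, ← ENNReal.ofReal_coe_nnreal] at this
      exact (ENNReal.ofReal_lt_ofReal_iff_of_nonneg hγ.length_nonneg).1 this
  have hgy : ∀ y ∈ Q \ relInterior M Q, ∀ γ l, IsShortestArc M γ l P y →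
      y ∈ e '' tangentBall M P r ∧ g y = l • deriv γ 0 := by
    intro y hy γ l hγ
    obtain ⟨h1, h2⟩ := he.apply_arc hγ hγ.length_nonneg (hlr y hy γ l hγ).2
    rw [hγ.target] at h2
    refine ⟨⟨_, h1, h2⟩, ?_⟩
    rw [← h2]
    exact he.injOn.leftInvOn_invFunOn h1
  have hθ : ∀ y ∈ Q \ relInterior M Q, ∀ γ l, IsShortestArc M γ l P y →
      deriv γ 0 = ‖g y‖⁻¹ • g y := by
    intro y hy γ l hγ
    have hl := (hlr y hy γ l hγ).1
    rw [(hgy y hy γ l hγ).2, norm_smul, hγ.unitSpeed, Real.norm_eq_abs, abs_of_pos hl, mul_one,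
      smul_smul, inv_mul_cancel₀ hl.ne', one_smul]
  refine ⟨fun y => ‖g y‖⁻¹ • g y, ?_, ?_, ?_, hθ⟩
  · have hcont : ContinuousOn g (Q \ relInterior M Q) := he.continuousOn_invFunOn.mono fun y hy => by
      obtain ⟨γ, l, hγ, -⟩ := hQ P hP.1 y hy.1
      exact (hgy y hy γ l hγ).1
    refine (hcont.norm.inv₀ fun y hy => ?_).smul hcont
    obtain ⟨γ, l, hγ, -⟩ := hQ P hP.1 y hy.1
    rw [(hgy y hy γ l hγ).2, norm_smul, hγ.unitSpeed, mul_one]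
    exact norm_ne_zero_iff.2 (hlr y hy γ l hγ).1.ne'
  · intro y hy y' hy' heq
    obtain ⟨γ, l, hγ, -⟩ := hQ P hP.1 y hy.1
    obtain ⟨γ', l', hγ', -⟩ := hQ P hP.1 y' hy'.1
    refine hQ.eq_of_deriv_eq hr hP hy hy' hγ hγ' (hlr y hy γ l hγ).2 (hlr y' hy' γ' l' hγ').2 ?_
    rw [hθ y hy γ l hγ, hθ y' hy' γ' l' hγ']
    exact heq
  · intro y hy
    obtain ⟨γ, l, hγ, -⟩ := hQ P hP.1 y hy.1
    simp only [← hθ y hy γ l hγ]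
    exact ⟨hγ.source ▸ hγ.geodesic.deriv_mem 0, hγ.unitSpeed 0⟩

/-- The initial velocity of a unit speed geodesic, scaled by `w`, is the inverse image under the
exponential map of the point at arc length `w`. -/
lemma IsShortestArc.isExpInverse {M : Set E3} {γ : ℝ → E3} {l w : ℝ} {p q : E3}
    (h : IsShortestArc M γ l p q) (hw : 0 < w) : IsExpInverse M p γ w (w • deriv γ 0) := by
  have hmem : w • deriv γ 0 ∈ tangentPlane M p :=
    smul_mem_tangentPlane (h.source ▸ h.geodesic.deriv_mem 0) w
  have hnorm : ‖w • deriv γ 0‖ = w := by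
    rw [norm_smul, h.unitSpeed, mul_one, Real.norm_eq_abs, abs_of_pos hw]
  have hexp : ∀ t : ℝ, IsExp M p (t • deriv γ 0) (γ t) := fun t =>
    ⟨_, h.geodesic.affine 0 t, by simp [h.source], by rw [h.geodesic.deriv_affine]; simp, by simp⟩
  refine ⟨hmem, hnorm, hexp w, fun s _ => by rw [smul_smul]; exact hexp _, ?_⟩
  intro hwr v' hv' hv'r hexp'
  -- A radius exceeding both `w` and `‖v'‖` but below the injectivity radius puts both vectors in a
  -- ball where `e` is injective.
  obtain ⟨r, hr, hri⟩ := ENNReal.lt_iff_exists_nnreal_btwn.1 (max_lt hwr hv'r)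
  obtain ⟨e, he⟩ := exists_isExpHomeo_of_lt_injRadiusAt hri
  have hlt : ∀ a : ℝ, 0 ≤ a → ENNReal.ofReal a < r → a < r := fun a ha har => by
    rwa [← ENNReal.ofReal_coe_nnreal, ENNReal.ofReal_lt_ofReal_iff_of_nonneg ha] at har
  have h1 : w • deriv γ 0 ∈ tangentBall M p r :=
    ⟨hmem, hnorm.symm ▸ hlt w hw.le ((le_max_left _ _).trans_lt hr)⟩
  have h2 : v' ∈ tangentBall M p r :=
    ⟨hv', hlt _ (norm_nonneg _) ((le_max_right _ _).trans_lt hr)⟩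
  exact he.injOn h2 h1 (((he.exp _ h2 _).1 hexp').symm.trans ((he.exp _ h1 _).1 (hexp w)))

end ConvexSurface

/-! ### The cyclic order of the directions and the conclusion -/

theorem proposition4p1
    (M : Set E3) (hM : IsConvexC2Surface M)
    (K₁ : ℝ) (hK₁ : 0 < K₁) (hK : CurvatureBoundedBelow M K₁)
    (V : Fin 4 → E3) (Q : Set E3) (hQ : IsConvexQuadrilateral M V Q)
    (hball : ∀ x ∈ Q, intrinsicDist M (V 0) x < injRadius M)
    (hper : perimeter M V < 2 * injRadius M)
    (w : Fin 4 → ℝ) (hw : ∀ i, 0 < w i)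
    (P : E3) (hmin : IsFermatTorricelliPoint M V w P) (hP : P ∈ relInterior M Q)
    (γ : Fin 4 → ℝ → E3) (l : Fin 4 → ℝ)
    (hγ : ∀ i, IsShortestArc M (γ i) (l i) P (V i)) :
    ∃ R' : Fin 4 → E3,
      (∀ i, IsExpInverse M P (γ i) (w i) (R' i)) ∧
      IsParallelogram (-R' 0) (R' 1) (-R' 2) (R' 3) := by
  have hconv : IsGeodesicallyConvex M Q := hQ.convex
  obtain ⟨σ, len, hσ, -, hdisj, hbdry⟩ := hQ.boundary
  have hσQ : ∀ i, ∀ s ∈ Icc 0 (len i), σ i s ∈ Q \ relInterior M Q := fun i s hs => by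
    rw [hbdry]
    exact mem_iUnion.2 ⟨i, s, hs, rfl⟩
  have hend : ∀ i, 0 ∈ Icc 0 (len i) ∧ len i ∈ Icc 0 (len i) := fun i =>
    ⟨⟨le_rfl, (hσ i).length_nonneg⟩, ⟨(hσ i).length_nonneg, le_rfl⟩⟩
  have hVQ : ∀ i, V i ∈ Q \ relInterior M Q := fun i => by
    rw [← (hσ i).source]
    exact hσQ i 0 (hend i).1
  have hl : ∀ i, 0 < l i := fun i => by
    refine (hγ i).length_nonneg.lt_of_ne fun h => (hVQ i).2 ?_
    rw [← (hγ i).target, ← h, (hγ i).source]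
    exact hP
  have hhalf : perimeter M V / 2 < injRadius M := ENNReal.div_lt_of_lt_mul' hper
  -- Two radii are needed: `ρ` is that of the separating circle, and `r` leaves room for the closed
  -- disc of radius `ρ` in the domain of the exponential map.
  obtain ⟨ρ, hρ, hρi⟩ := ENNReal.lt_iff_exists_nnreal_btwn.1 hhalf
  obtain ⟨r, hρr, hri⟩ := ENNReal.lt_iff_exists_nnreal_btwn.1 hρi
  have hρ0 : 0 < ρ := by exact_mod_cast zero_le.trans_lt hρ
  have hρr' : ρ < r := by exact_mod_cast hρr
  have hexp : ∀ x ∈ Q, ∃ e, IsExpHomeo M x r e := fun x hx =>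
    exists_isExpHomeo_of_lt_injRadius (hQ.subset hx) hri
  have hnear : ∀ y ∈ Q \ relInterior M Q, intrinsicDist M P y < r := by
    intro y hy
    obtain ⟨e, he⟩ := hexp y hy.1
    -- The estimate is centred at the boundary point `y`, because the perimeter controls only
    -- distances between boundary points; it then applies to `P` as a point of `Q`.
    rw [intrinsicDist_comm]
    refine (hconv.intrinsicDist_lt hM hQ.subset hQ.isCompact.isClosed he hy hρ0 hρr'
      (fun x hx => ?_) hP.1).trans hρr
    refine lt_of_le_of_lt ?_ hρ
    rw [ENNReal.le_div_iff_mul_le (by simp) (by simp), mul_comm]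
    exact two_mul_intrinsicDist_le_perimeter hσ (hbdry ▸ hy) (hbdry ▸ hx)
  obtain ⟨θ, hθc, hθi, hθT, hθ⟩ := hconv.exists_direction hexp hP hnear
  obtain ⟨T, hT2, hT⟩ := exists_submodule_eq_tangentPlane hM (hQ.subset hP.1)
  obtain ⟨Φ, hΦ⟩ := exists_plane_coordinates hT2
  have hmemT : ∀ y ∈ Q \ relInterior M Q, θ y ∈ T := fun y hy => by
    rw [← SetLike.mem_coe, hT]
    exact (hθT y hy).1
  have hΦn : ∀ y ∈ Q \ relInterior M Q, ‖Φ (θ y)‖ = 1 := fun y hy => by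
    rw [hΦ _ (hmemT y hy), (hθT y hy).2]
  have hΦi : ∀ y ∈ Q \ relInterior M Q, ∀ y' ∈ Q \ relInterior M Q, y ≠ y' →
      Φ (θ y) ≠ Φ (θ y') := fun y hy y' hy' hne heq => hne <| hθi hy hy' <| by
    rw [← sub_eq_zero, ← norm_eq_zero, ← hΦ _ (T.sub_mem (hmemT y hy) (hmemT y' hy')), map_sub,
      heq, sub_self, norm_zero]
  have hu : ∀ i, deriv (γ i) 0 = θ (V i) := fun i => hθ _ (hVQ i) _ _ (hγ i)
  have hVne : ∀ i, V i ≠ V (i + 1) := fun i h => by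
    have h3 : ∀ i : Fin 4, i + 1 + 2 + 1 = i := by decide
    -- `V (i + 1)` starts side `i + 1` and `V i` ends side `i + 3`; these two sides are opposite,
    -- hence disjoint.
    refine disjoint_iff_forall_ne.1 (hdisj (i + 1)) ⟨0, (hend _).1, (hσ _).source⟩
      ⟨len (i + 1 + 2), (hend _).2, (hσ _).target⟩ ?_
    rw [h3, h]
  have hside : ∀ i, 0 < signedArea (Φ (θ (V (i + 2))))
      (Φ (θ (V (i + 2 + 1)))) (Φ (θ (V i))) * signedArea (Φ (θ (V (i + 2))))
      (Φ (θ (V (i + 2 + 1)))) (Φ (θ (V (i + 1)))) := by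
    intro i
    have havoid : ∀ s ∈ Icc 0 (len i), ∀ t ∈ Icc 0 (len (i + 2)), σ i s ≠ σ (i + 2) t :=
      fun s hs t ht => disjoint_iff_forall_ne.1 (hdisj i) ⟨s, hs, rfl⟩ ⟨t, ht, rfl⟩
    have := signedArea_mul_pos_of_path (hΦn _ (hVQ (i + 2))) (hΦn _ (hVQ (i + 2 + 1)))
      (hΦi _ (hVQ _) _ (hVQ _) (hVne _)) (θ := fun s => Φ (θ (σ i s))) (hσ i).length_nonneg
      (Φ.continuous.comp_continuousOn (hθc.comp (hσ i).continuous.continuousOn (hσQ i)))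
      (fun s hs => hΦn _ (hσQ i s hs))
      (fun s hs => hΦi _ (hσQ i s hs) _ (hVQ _) fun h =>
        havoid s hs _ (hend _).1 (h.trans (hσ _).source.symm))
      (fun s hs => hΦi _ (hσQ i s hs) _ (hVQ _) fun h =>
        havoid s hs _ (hend _).2 (h.trans (hσ _).target.symm))
    simpa only [(hσ i).source, (hσ i).target] using this
  refine ⟨fun i => w i • deriv (γ i) 0, fun i => (hγ i).isExpInverse (hw i), ?_⟩
  have hbal := hmin.sum_smul_deriv_eq_zero hM hw hγ hl
  refine isParallelogram_of_signedArea (Φ := Φ) (u := fun i => deriv (γ i) 0) hw hbal ?_ ?_ ?_ <;>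
    simp only [hu]
  -- Three sides suffice: they link the signs of all four triangle areas.
  exacts [hside 0, hside 1, hside 2]
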